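/- **Setting.** Fix a subjective Markov decision process (SMDP): nonempty finite sets $\mathbb S$ of states and $\mathbb X$ of actions; a correspondence $\Gamma$ assigning to each $s\in\mathbb S$ a nonempty set $\Gamma(s)\subseteq\mathbb X$ of feasible actions, with graph $G=\{(s,x):x\in\Gamma(s)\}$; an initial distribution $q_0\in\Delta(\mathbb S)$; a true transition function $Q:G\to\Delta(\mathbb S)$; a payoff $\pi:G\times\mathbb S\to\mathbb R$; and a family $Q_\theta:G\to\Delta(\mathbb S)$, $\theta\in\Theta$, where $\Theta\neq\emptyset$ is a subset of a Euclidean space. The discount factor is $\delta\in[0,1)$. The SMDP is *regular* if $\Theta$ is compact, $\theta\mapsto Q_\theta(s'\mid s,x)$ is continuous for all $s',s,x$, and there is a dense $\hat\Theta\subseteq\Theta$ such that for $\theta\in\hat\Theta$: $Q_\theta(s'\mid s,x)>0$ whenever $Q(s'\mid s,x)>0$. A *strategy* $\sigma$ assigns to each state $s$ a distribution $\sigma(\cdot\mid s)$ on $\Gamma(s)$; $\Sigma$ is the set of strategies. For a belief $\mu\in\Delta(\Theta)$ put $\bar Q_\mu=\int Q_\theta\,\mu(d\theta)$, and let $B(s,x,s',\mu)$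 be the posterior $A\mapsto\int_A Q_\theta(s'\mid s,x)\mu(d\theta)/\bar Q_\mu(s'\mid s,x)$ (arbitrary when the denominator is $0$). *Berk-Nash equilibrium.* $(\sigma,m)\in\Sigma\times\Delta(G)$ is a Berk-Nash equilibrium if there is $\mu\in\Delta(\Theta)$ such that: (a) $\sigma$ is optimal in the MDP with transition function $\bar Q_\mu$, i.e. $\sigma(\cdot\mid s)$ is supported on $\arg\max_{x\in\Gamma(s)}\sum_{s'}\{\pi(s,x,s')+\delta V(s')\}\bar Q_\mu(s'\mid s,x)$ for each $s$, where $V$ is the solution of the Bellman equation whose right-hand side is this maximum; (b) $\mu$ gives probability one to the set of minimizers over $\theta\in\Theta$ of $K_Q(m,\theta)=\sum_{(s,x)\in G}m(s,x)\sum_{s'}Q(s'\mid s,x)\ln\frac{Q(s'\mid s,x)}{Q_\theta(s'\mid s,x)}\in[0,\infty]$; (c) $m(s',x')=\sum_{(s,x)\in G}\sigma(x'\mid s')Q(s'\mid s,x)\,m(s,x)$ for all $(s',x')\in G$. *Learning.* A policy function $f:\Delta(\Theta)\to\Sigma$ is *optimal* if for all $\mu,s$, $f(\cdot\mid s,\mu)$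 is supported on $\arg\max_{x\in\Gamma(s)}\sum_{s'}\{\pi(s,x,s')+\delta W(s',B(s,x,s',\mu))\}\bar Q_\mu(s'\mid s,x)$, where $W:\mathbb S\times\Delta(\Theta)\to\mathbb R$ is the bounded solution of the Bellman equation whose right-hand side is this maximum. A prior $\mu_0$ and $f$ induce a law $\mathbf P^f$ on histories $h=(s_0,x_0,s_1,x_1,\dots)\in G^{\infty}$: $s_0\sim q_0$, $x_t\sim f(\cdot\mid s_t,\mu_t)$, $s_{t+1}\sim Q(\cdot\mid s_t,x_t)$, $\mu_{t+1}=B(s_t,x_t,s_{t+1},\mu_t)$. Let $\sigma_t(h)=f(\cdot\mid\cdot,\mu_t(h))$ and let $m_t(h)\in\Delta(G)$ be the empirical frequency of the outcomes $(s_\tau,x_\tau)$, $\tau\le t$. The pair $(\sigma,m)$ is *stable* if there is a set $\mathcal H$ of histories with $\mathbf P^f(\mathcal H)>0$ such that $\sigma_t(h)\to\sigma$ and $m_t(h)\to m$ for all $h\in\mathcal H$. It is *stable with exhaustive learning* if, in addition, for each $h\in\mathcal H$ some subsequence of $(\mu_t(h))_t$ converges weakly to a belief $\mu^*$ such that $\mu^*=B(s,x,s',\mu^*)$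 for all $(s,x)\in G$ and all $s'$ with $\bar Q_{\mu^*}(s'\mid s,x)>0$. **Theorem.** For every SMDP as above there exists $\bar\delta\in[0,1]$ (not depending on $\delta$, $\mu_0$, $f$, $\sigma$, $m$) such that, if the SMDP is regular, $\mu_0\in\Delta(\Theta)$ is a prior with full support, and $f$ is an optimal policy function for the discount factor $\delta$: (i) for all $\delta\in[0,1)$ with $\delta\le\bar\delta$, if $(\sigma,m)$ is stable, then $(\sigma,m)$ is a Berk-Nash equilibrium of the SMDP; (ii) for all $\delta\in[0,1)$ with $\delta>\bar\delta$, if $(\sigma,m)$ is stable with exhaustive learning, then $(\sigma,m)$ is a Berk-Nash equilibrium of the SMDP. -/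

import Mathlib

open Filter Topology MeasureTheory ProbabilityTheory

noncomputable section

/-- The graph `{(s, x) : x ∈ Γ s}` of a constraint correspondence: the feasible outcomes. -/
def Gr {S X : Type*} (Γ : S → Finset X) : Type _ := {p : S × X // p.2 ∈ Γ p.1}

namespace Gr

variable {S X : Type*} {Γ : S → Finset X}

/-- The state of an outcome. -/
def state (z : Gr Γ) : S := z.1.1

/-- The action of an outcome. -/
def action (z : Gr Γ) : X := z.1.2

open Classical in
instance [Fintype S] [Fintype X] : Fintype (Gr Γ) :=
  inferInstanceAs (Fintype {p : S × X // p.2 ∈ Γ p.1})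

instance : MeasurableSpace (Gr Γ) := ⊤

instance : DiscreteMeasurableSpace (Gr Γ) := ⟨fun _ => trivial⟩

/-- For a function `u` on outcomes, `IsArgmax u z` says that the action of `z` maximizes
`x ↦ u (s, x)` over `x ∈ Γ s`, where `s` is the state of `z`. -/
def IsArgmax (u : Gr Γ → ℝ) (z : Gr Γ) : Prop :=
  ∀ z' : Gr Γ, z'.state = z.state → u z' ≤ u z

/-- `IsMaxAt u s v` says that `v = max_{x ∈ Γ s} u (s, x)` (the maximum being attained). -/
def IsMaxAt (u : Gr Γ → ℝ) (s : S) (v : ℝ) : Prop :=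
  IsGreatest {r : ℝ | ∃ z : Gr Γ, z.state = s ∧ u z = r} v

end Gr

/-- Strategies: maps from states to distributions over actions, supported on feasible actions.
The topology is that of pointwise convergence. -/
abbrev Strategy {S X : Type*} [Fintype X] (Γ : S → Finset X) : Type _ :=
  {σ : S → X → ℝ // ∀ s, σ s ∈ stdSimplex ℝ X ∧ ∀ x, x ∉ Γ s → σ s x = 0}

/-- Distributions over outcomes, with the topology of pointwise convergence. -/
abbrev OutcomeDist {S X : Type*} [Fintype S] [Fintype X] (Γ : S → Finset X) : Type _ :=
  stdSimplex ℝ (Gr Γ)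

lemma sum_weights {S X : Type*} [Fintype S] [Fintype X] {Γ : S → Finset X}
    (p : stdSimplex ℝ S) (g : Strategy Γ) :
    ∑ z : Gr Γ, p.1 z.state * g.1 z.state z.action = 1 := by
  classical
  have h1 : ∑ z : Gr Γ, p.1 z.state * g.1 z.state z.action
      = ∑ a ∈ (Finset.univ : Finset (S × X)).filter (fun a => a.2 ∈ Γ a.1),
          p.1 a.1 * g.1 a.1 a.2 := by
    rw [Finset.sum_subtype (p := fun a : S × X => a.2 ∈ Γ a.1) (F := inferInstance)]
    · exact Finset.sum_congr rfl (fun _ _ => rfl)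
    · simp
  rw [h1, Finset.sum_filter_of_ne, Fintype.sum_prod_type]
  · simp_rw [← Finset.mul_sum, (g.2 _).1.2, mul_one, p.2.2]
  · intro a _ ha
    by_contra hn
    exact ha (by rw [(g.2 a.1).2 _ hn, mul_zero])

/-- The law of an outcome `(s, x)` when `s` is drawn from `p` and then `x` from `g (· ∣ s)`. -/
def outcomeLaw {S X : Type*} [Fintype S] [Fintype X] {Γ : S → Finset X}
    (p : stdSimplex ℝ S) (g : Strategy Γ) : Measure (Gr Γ) :=
  ∑ z : Gr Γ, ENNReal.ofReal (p.1 z.state * g.1 z.state z.action) • Measure.dirac z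

instance {S X : Type*} [Fintype S] [Fintype X] {Γ : S → Finset X}
    (p : stdSimplex ℝ S) (g : Strategy Γ) : IsProbabilityMeasure (outcomeLaw p g) := by
  refine ⟨?_⟩
  simp only [outcomeLaw, Measure.coe_finsetSum, Finset.sum_apply, Measure.smul_apply,
    measure_univ, smul_eq_mul, mul_one]
  rw [← ENNReal.ofReal_sum_of_nonneg, sum_weights, ENNReal.ofReal_one]
  exact fun z _ => mul_nonneg (p.2.1 _) ((g.2 _).1.1 _)

/-- A Markov decision process with finitely many states and actions. The discount factor `δ` is
not a field: it is an explicit argument of the notions that depend on it, so that it can vary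
while everything else is fixed. -/
structure MDP (S X : Type*) [Fintype S] [Fintype X] where
  /-- the constraint correspondence -/
  Γ : S → Finset X
  Γ_nonempty : ∀ s, (Γ s).Nonempty
  /-- the distribution of the initial state -/
  q₀ : stdSimplex ℝ S
  /-- the true transition probability function, `(Q (s, x)).1 s' = Q(s' ∣ s, x)` -/
  Q : Gr Γ → stdSimplex ℝ S
  /-- the per-period payoff -/
  payoff : Gr Γ → S → ℝ

/-- A subjective Markov decision process: a Markov decision process together with a nonempty
family of transition probability functions indexed by a set `Θ` of parameters. -/
structure SMDP (S X : Type*) [Fintype S] [Fintype X] {d : ℕ}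
    (Θ : Set (EuclideanSpace ℝ (Fin d))) extends MDP S X where
  Θ_nonempty : Θ.Nonempty
  /-- the subjective models, `(model θ (s, x)).1 s' = Q_θ(s' ∣ s, x)` -/
  model : Θ → Gr Γ → stdSimplex ℝ S

namespace MDP

variable {S X : Type*} [Fintype S] [Fintype X] (D : MDP S X)

/-- `∫ {π(s, x, s') + δ V(s')} q(ds' ∣ s, x)` for the outcome `z = (s, x)`. -/
def actionValue (δ : ℝ) (q : Gr D.Γ → S → ℝ) (V : S → ℝ) (z : Gr D.Γ) : ℝ :=
  ∑ s', (D.payoff z s' + δ * V s') * q z s'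

/-- `V` solves the Bellman equation of the MDP with transition probability function `q`. -/
def IsValue (δ : ℝ) (q : Gr D.Γ → S → ℝ) (V : S → ℝ) : Prop :=
  ∀ s, Gr.IsMaxAt (D.actionValue δ q V) s (V s)

/-- `σ` is an optimal strategy for the MDP with transition probability function `q`. (For
`δ ∈ [0,1)` the Bellman equation has exactly one solution.) -/
def IsOptimal (δ : ℝ) (q : Gr D.Γ → S → ℝ) (σ : Strategy D.Γ) : Prop :=
  ∃ V : S → ℝ, D.IsValue δ q V ∧
    ∀ z : Gr D.Γ, 0 < σ.1 z.state z.action → Gr.IsArgmax (D.actionValue δ q V) z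

/-- The transition kernel `M_{σ,Q}(z' ∣ z) = σ(x' ∣ s') Q(s' ∣ s, x)` on outcomes,
`z = (s, x)`, `z' = (s', x')`, for the true transition probability function. -/
def transition (σ : Strategy D.Γ) (z z' : Gr D.Γ) : ℝ :=
  σ.1 z'.state z'.action * (D.Q z).1 z'.state

/-- `m` is a stationary distribution given `(σ, Q)`. -/
def IsStationary (σ : Strategy D.Γ) (m : OutcomeDist D.Γ) : Prop :=
  ∀ z', m.1 z' = ∑ z, D.transition σ z z' * m.1 z

end MDP

/-- The summand `p log (p / q)` of the Kullback-Leibler divergence, with the usual conventions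
`0 log (0 / q) = 0` and `p log (p / 0) = ∞` for `p > 0`. -/
def klTerm (p q : ℝ) : EReal :=
  open Classical in
  if p = 0 then 0 else if q = 0 then ⊤ else ((p * Real.log (p / q) : ℝ) : EReal)

namespace SMDP

variable {S X : Type*} [Fintype S] [Fintype X] {d : ℕ} {Θ : Set (EuclideanSpace ℝ (Fin d))}
  (D : SMDP S X Θ)

/-- Regularity: compact parameter set, continuity of the models in the parameter, and a dense set
of models that give positive probability to all feasible transitions. -/
structure Regular : Prop where
  compact : IsCompact Θ
  continuous : ∀ (z : Gr D.Γ) (s' : S), Continuous fun θ : Θ => (D.model θ z).1 s'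
  dense : ∃ A : Set Θ, Dense A ∧
    ∀ θ ∈ A, ∀ (z : Gr D.Γ) (s' : S), 0 < (D.Q z).1 s' → 0 < (D.model θ z).1 s'

/-- The weighted Kullback-Leibler divergence `K_Q(m, θ)`, an extended real number
(in `EReal` one has `0 * ⊤ = 0`). -/
def wKLD (m : OutcomeDist D.Γ) (θ : Θ) : EReal :=
  ∑ z : Gr D.Γ, (m.1 z : EReal) * ∑ s', klTerm ((D.Q z).1 s') ((D.model θ z).1 s')

/-- The set `Θ_Q(m)` of closest parameter values given `m`. -/
def closest (m : OutcomeDist D.Γ) : Set Θ :=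
  {θ | ∀ θ', D.wKLD m θ ≤ D.wKLD m θ'}

/-- The subjective transition probability `Q̄_μ(s' ∣ s, x) = ∫ Q_θ(s' ∣ s, x) μ(dθ)`. -/
def Qbar (μ : ProbabilityMeasure Θ) (z : Gr D.Γ) (s' : S) : ℝ :=
  ∫ θ, (D.model θ z).1 s' ∂(μ : Measure Θ)

/-- `(σ, m)` is a Berk-Nash equilibrium (for the discount factor `δ`). -/
def IsBerkNash (δ : ℝ) (σ : Strategy D.Γ) (m : OutcomeDist D.Γ) : Prop :=
  ∃ μ : ProbabilityMeasure Θ,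
    D.IsOptimal δ (D.Qbar μ) σ ∧
    (∀ᵐ θ ∂(μ : Measure Θ), θ ∈ D.closest m) ∧
    D.IsStationary σ m

lemma isProbabilityMeasure_posterior (z : Gr D.Γ) (s' : S) (μ : ProbabilityMeasure Θ)
    (h : 0 < D.Qbar μ z s') :
    IsProbabilityMeasure ((ENNReal.ofReal (D.Qbar μ z s'))⁻¹ •
      (μ : Measure Θ).withDensity fun θ => ENNReal.ofReal ((D.model θ z).1 s')) := by
  have hi : Integrable (fun θ => (D.model θ z).1 s') (μ : Measure Θ) := by
    by_contra hn
    exact h.ne' (integral_undef hn)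
  refine ⟨?_⟩
  rw [Measure.smul_apply, withDensity_apply _ MeasurableSet.univ, Measure.restrict_univ,
    ← ofReal_integral_eq_lintegral_ofReal hi (ae_of_all _ fun θ => (D.model θ z).2.1 s'),
    smul_eq_mul]
  exact ENNReal.inv_mul_cancel (by simpa using h) ENNReal.ofReal_ne_top

open Classical in
/-- The Bayesian operator `B(s, x, s', μ)`, with `z = (s, x)`: the posterior
`A ↦ ∫_A Q_θ(s' ∣ s, x) μ(dθ) / ∫_Θ Q_θ(s' ∣ s, x) μ(dθ)` where the denominator is positive
(and `μ` itself otherwise, an arbitrary choice). -/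
def bayes (z : Gr D.Γ) (s' : S) (μ : ProbabilityMeasure Θ) : ProbabilityMeasure Θ :=
  if h : 0 < D.Qbar μ z s' then
    ⟨(ENNReal.ofReal (D.Qbar μ z s'))⁻¹ •
      (μ : Measure Θ).withDensity fun θ => ENNReal.ofReal ((D.model θ z).1 s'),
      D.isProbabilityMeasure_posterior z s' μ h⟩
  else μ

/-- `∫ {π(s, x, s') + δ W(s', B(s, x, s', μ))} Q̄_μ(ds' ∣ s, x)` for the outcome `z = (s, x)`. -/
def bayesActionValue (δ : ℝ) (W : S → ProbabilityMeasure Θ → ℝ) (μ : ProbabilityMeasure Θ)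
    (z : Gr D.Γ) : ℝ :=
  ∑ s', (D.payoff z s' + δ * W s' (D.bayes z s' μ)) * D.Qbar μ z s'

/-- `W` is the value function of the Bayesian problem: the bounded solution of the Bellman equation
in which the belief is part of the state. -/
def IsBayesValue (δ : ℝ) (W : S → ProbabilityMeasure Θ → ℝ) : Prop :=
  (∃ C, ∀ s μ, |W s μ| ≤ C) ∧
    ∀ s μ, Gr.IsMaxAt (D.bayesActionValue δ W μ) s (W s μ)

/-- A policy function `f`, mapping beliefs to strategies, is optimal for the Bayesian problem.
(For `δ ∈ [0,1)` the Bellman equation has exactly one bounded solution.) -/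
def IsOptimalPolicy (δ : ℝ) (f : ProbabilityMeasure Θ → Strategy D.Γ) : Prop :=
  ∃ W : S → ProbabilityMeasure Θ → ℝ, D.IsBayesValue δ W ∧
    ∀ (μ : ProbabilityMeasure Θ) (z : Gr D.Γ), 0 < (f μ).1 z.state z.action →
      Gr.IsArgmax (D.bayesActionValue δ W μ) z

/-- The belief `μ_t` after the infinite history `h = (s₀, x₀, s₁, x₁, …)`. -/
def belief (μ₀ : ProbabilityMeasure Θ) (h : ℕ → Gr D.Γ) : ℕ → ProbabilityMeasure Θ
  | 0 => μ₀
  | t + 1 => D.bayes (h t) (h (t + 1)).state (belief μ₀ h t)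

/-- Given the current outcome `z` and belief `μ`, the behavior next period: in state `s'` the agent
first updates to `B(z, s', μ)` and then follows the policy function. -/
def nextStrategy (f : ProbabilityMeasure Θ → Strategy D.Γ) (μ : ProbabilityMeasure Θ)
    (z : Gr D.Γ) : Strategy D.Γ :=
  ⟨fun s' => (f (D.bayes z s' μ)).1 s', fun s' => (f (D.bayes z s' μ)).2 s'⟩

/-- A finite history `(z₀, …, z_t)`, continued in an arbitrary way to an infinite one (beliefs up to
time `t` depend on `z₀, …, z_t` only). -/
def extend {t : ℕ} (h : Π _ : Finset.Iic t, Gr D.Γ) : ℕ → Gr D.Γ :=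
  fun i => h ⟨min i t, Finset.mem_Iic.2 (min_le_right i t)⟩

/-- The law of the outcome of period `t + 1` given the outcomes of periods `0, …, t`: the new state
is drawn from the true transition probability, and the action from the policy function at the
updated belief. -/
def stepKernel (μ₀ : ProbabilityMeasure Θ) (f : ProbabilityMeasure Θ → Strategy D.Γ) (t : ℕ) :
    Kernel (Π _ : Finset.Iic t, Gr D.Γ) (Gr D.Γ) :=
  Kernel.ofFunOfCountable fun h =>
    outcomeLaw (D.Q (D.extend h t))
      (D.nextStrategy f (D.belief μ₀ (D.extend h) t) (D.extend h t))

instance (μ₀ : ProbabilityMeasure Θ) (f : ProbabilityMeasure Θ → Strategy D.Γ) (t : ℕ) :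
    IsMarkovKernel (D.stepKernel μ₀ f t) :=
  ⟨fun h => inferInstanceAs (IsProbabilityMeasure (outcomeLaw (D.Q (D.extend h t))
      (D.nextStrategy f (D.belief μ₀ (D.extend h) t) (D.extend h t))))⟩

/-- The probability distribution `P^f` over infinite histories induced by the primitives, the prior
and the policy function (Ionescu-Tulcea). -/
def historyLaw (μ₀ : ProbabilityMeasure Θ) (f : ProbabilityMeasure Θ → Strategy D.Γ) :
    Measure (ℕ → Gr D.Γ) :=
  Kernel.trajMeasure (X := fun _ => Gr D.Γ) (outcomeLaw D.q₀ (f μ₀)) (D.stepKernel μ₀ f)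

open Classical in
/-- The empirical frequency `m_t` of the outcomes of periods `0, …, t`. -/
def freq (h : ℕ → Gr D.Γ) (t : ℕ) (z : Gr D.Γ) : ℝ :=
  (1 / ((t : ℝ) + 1)) * ∑ τ ∈ Finset.range (t + 1), if h τ = z then 1 else 0

/-- Along the history `h`, strategies converge to `σ` and empirical frequencies to `m`. -/
def Converges (μ₀ : ProbabilityMeasure Θ) (f : ProbabilityMeasure Θ → Strategy D.Γ)
    (σ : Strategy D.Γ) (m : OutcomeDist D.Γ) (h : ℕ → Gr D.Γ) : Prop :=
  Tendsto (fun t => f (D.belief μ₀ h t)) atTop (𝓝 σ) ∧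
    ∀ z, Tendsto (fun t => D.freq h t z) atTop (𝓝 (m.1 z))

/-- `(σ, m)` is stable for the prior `μ₀` and the policy function `f`. -/
def IsStable (μ₀ : ProbabilityMeasure Θ) (f : ProbabilityMeasure Θ → Strategy D.Γ)
    (σ : Strategy D.Γ) (m : OutcomeDist D.Γ) : Prop :=
  ∃ H : Set (ℕ → Gr D.Γ), MeasurableSet H ∧ 0 < D.historyLaw μ₀ f H ∧
    ∀ h ∈ H, D.Converges μ₀ f σ m h

/-- Under the belief `μ` all learning possibilities are exhausted: `μ` is a fixed point of the
Bayesian operator at every transition that has positive probability under `Q̄_μ`. -/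
def Exhausted (μ : ProbabilityMeasure Θ) : Prop :=
  ∀ (z : Gr D.Γ) (s' : S), 0 < D.Qbar μ z s' → μ = D.bayes z s' μ

/-- `(σ, m)` is stable with exhaustive learning: it is stable, and along each history in question
some subsequence of beliefs converges weakly to a belief under which learning is exhausted. -/
def IsStableExhaustive (μ₀ : ProbabilityMeasure Θ) (f : ProbabilityMeasure Θ → Strategy D.Γ)
    (σ : Strategy D.Γ) (m : OutcomeDist D.Γ) : Prop :=
  ∃ H : Set (ℕ → Gr D.Γ), MeasurableSet H ∧ 0 < D.historyLaw μ₀ f H ∧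
    ∀ h ∈ H, D.Converges μ₀ f σ m h ∧
      ∃ (μ : ProbabilityMeasure Θ) (φ : ℕ → ℕ), StrictMono φ ∧
        Tendsto (fun j => D.belief μ₀ h (φ j)) atTop (𝓝 μ) ∧ D.Exhausted μ

end SMDP

/-- A belief has full support if it charges every nonempty (relatively) open set of parameters. -/
def FullSupport {d : ℕ} {Θ : Set (EuclideanSpace ℝ (Fin d))} (μ : ProbabilityMeasure Θ) : Prop :=
  ∀ U : Set Θ, IsOpen U → U.Nonempty → 0 < (μ : Measure Θ) U

end

/-! Along almost every history, the law of large numbers makes the frequency of each transition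
`(s, x, s')` converge to `m(s, x) Q(s' ∣ s, x)`; averaging the action frequencies in the same way
shows that `m` is stationary. Beliefs are the prior reweighted by the likelihood of the observed
transitions, which at every model that is not closest to `Q` given `m` is exponentially smaller than
near a better model, so every limit belief `μ` is concentrated on the closest models. Value
iteration shows that the Bayesian value function is continuous in the belief, so the limit strategy
is optimal in the Bayesian problem at `μ`. If the agent is myopic, or if no transition changes `μ`,
then that problem is the MDP with transition function `Q̄_μ`; hence `δbar = 0` is a valid
threshold. -/

section CesaroMean

/-- The mean of the first `n` terms of a real sequence, equal to `0` for `n = 0`. -/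
noncomputable def cesaroMean (x : ℕ → ℝ) (n : ℕ) : ℝ :=
  (∑ i ∈ Finset.range n, x i) / n

lemma cesaroMean_add (x y : ℕ → ℝ) (n : ℕ) :
    cesaroMean (fun i => x i + y i) n = cesaroMean x n + cesaroMean y n := by
  rw [cesaroMean, Finset.sum_add_distrib, add_div, cesaroMean, cesaroMean]

lemma cesaroMean_mul_const (x : ℕ → ℝ) (c : ℝ) (n : ℕ) :
    cesaroMean (fun i => x i * c) n = cesaroMean x n * c := by
  rw [cesaroMean, cesaroMean, ← Finset.sum_mul, div_mul_eq_mul_div]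

lemma cesaroMean_sum {ι : Type*} (I : Finset ι) (x : ι → ℕ → ℝ) (n : ℕ) :
    cesaroMean (fun i => ∑ a ∈ I, x a i) n = ∑ a ∈ I, cesaroMean (x a) n := by
  simp only [cesaroMean]
  rw [Finset.sum_comm, Finset.sum_div]

lemma abs_cesaroMean_le {x : ℕ → ℝ} {C : ℝ} (hx : ∀ i, |x i| ≤ C) (n : ℕ) :
    |cesaroMean x n| ≤ C := by
  rw [cesaroMean, abs_div, Nat.abs_cast]
  refine div_le_of_le_mul₀ n.cast_nonneg ((abs_nonneg _).trans (hx 0)) ?_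
  calc |∑ i ∈ Finset.range n, x i| ≤ ∑ i ∈ Finset.range n, |x i| := Finset.abs_sum_le_sum_abs _ _
    _ ≤ ∑ _i ∈ Finset.range n, C := Finset.sum_le_sum fun i _ => hx i
    _ = C * n := by simp [mul_comm]

lemma tendsto_cesaroMean {x : ℕ → ℝ} {l : ℝ} (h : Tendsto x atTop (𝓝 l)) :
    Tendsto (cesaroMean x) atTop (𝓝 l) :=
  h.cesaro.congr fun _ => (div_eq_inv_mul _ _).symm

lemma tendsto_cesaroMean_succ {x : ℕ → ℝ} {l : ℝ} (h : Tendsto (cesaroMean x) atTop (𝓝 l)) :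
    Tendsto (cesaroMean fun i => x (i + 1)) atTop (𝓝 l) := by
  have hlim : Tendsto (fun n : ℕ => cesaroMean x (n + 1) * (1 + 1 / (n : ℝ)) - x 0 / n) atTop
      (𝓝 (l * (1 + 0) - 0)) :=
    (((tendsto_add_atTop_iff_nat 1).2 h).mul
      (tendsto_one_div_atTop_nhds_zero_nat.const_add 1)).sub
        (tendsto_const_nhds.div_atTop tendsto_natCast_atTop_atTop)
  rw [add_zero, mul_one, sub_zero] at hlim
  refine hlim.congr' ?_
  filter_upwards [eventually_gt_atTop 0] with n hn
  rw [cesaroMean, cesaroMean, Finset.sum_range_succ', Nat.cast_succ]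
  field_simp
  ring

-- Adding `C` to every term makes the partial sums monotone, and consecutive squares have ratio
-- tending to `1`.
lemma tendsto_cesaroMean_of_tendsto_sq {x : ℕ → ℝ} {C l : ℝ} (hx : ∀ i, |x i| ≤ C)
    (h : Tendsto (fun k : ℕ => cesaroMean x ((k + 1) ^ 2)) atTop (𝓝 l)) :
    Tendsto (cesaroMean x) atTop (𝓝 l) := by
  have hadd : ∀ n : ℕ, 0 < n →
      cesaroMean x n + C = (∑ i ∈ Finset.range n, (x i + C)) / n := fun n hn => by
    have : (n : ℝ) ≠ 0 := by positivity
    rw [Finset.sum_add_distrib, Finset.sum_const, Finset.card_range, nsmul_eq_mul, add_div,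
      mul_div_cancel_left₀ _ this, cesaroMean]
  have hmono : Monotone fun n => ∑ i ∈ Finset.range n, (x i + C) :=
    monotone_nat_of_le_succ fun n => by
      rw [Finset.sum_range_succ]
      linarith [(abs_le.1 (hx n)).1]
  have hlim : Tendsto (fun n : ℕ => (∑ i ∈ Finset.range n, (x i + C)) / n) atTop (𝓝 (l + C)) := by
    refine tendsto_div_of_monotone_of_exists_subseq_tendsto_div _ _ hmono fun a ha =>
      ⟨fun k => (k + 1) ^ 2, ?_, ?_, ?_⟩
    · filter_upwards [eventually_ge_atTop ⌈3 / (a - 1)⌉₊] with k hk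
      have hk' : 3 / (a - 1) ≤ (k : ℝ) := Nat.ceil_le.1 hk
      rw [div_le_iff₀ (sub_pos.2 ha)] at hk'
      push_cast
      nlinarith [Nat.cast_nonneg (α := ℝ) k]
    · exact (tendsto_pow_atTop two_ne_zero).comp (tendsto_add_atTop_nat 1)
    · exact (h.add_const C).congr fun k => hadd _ (by positivity)
  have hsub := hlim.sub_const C
  rw [add_sub_cancel_right] at hsub
  refine hsub.congr' ?_
  filter_upwards [eventually_gt_atTop 0] with n hn
  rw [← hadd n hn, add_sub_cancel_right]

end CesaroMean

section OrthogonalSequences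

variable {Ω : Type*} [MeasurableSpace Ω] {ρ : Measure Ω}

lemma ae_tendsto_zero_of_summable_integral {f : ℕ → Ω → ℝ} (hf : ∀ k, Integrable (f k) ρ)
    (hf0 : ∀ k ω, 0 ≤ f k ω) (hsum : Summable fun k => ∫ ω, f k ω ∂ρ) :
    ∀ᵐ ω ∂ρ, Tendsto (fun k => f k ω) atTop (𝓝 0) := by
  have hae : ∀ k, AEMeasurable (fun ω => ENNReal.ofReal (f k ω)) ρ :=
    fun k => (hf k).aestronglyMeasurable.aemeasurable.ennreal_ofReal
  have hfin : ∫⁻ ω, ∑' k, ENNReal.ofReal (f k ω) ∂ρ ≠ ⊤ := by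
    rw [lintegral_tsum hae]
    simp_rw [← ofReal_integral_eq_lintegral_ofReal (hf _) (ae_of_all _ (hf0 _))]
    exact hsum.tsum_ofReal_ne_top
  filter_upwards [ae_lt_top' (AEMeasurable.tsum hae) hfin] with ω hω
  refine ((ENNReal.tendsto_toReal ENNReal.zero_ne_top).comp
    (ENNReal.tendsto_atTop_zero_of_tsum_ne_top hω.ne)).congr fun k => ?_
  exact ENNReal.toReal_ofReal (hf0 k ω)

lemma integral_sum_sq_of_orthogonal {ι : Type*} {x : ι → Ω → ℝ} (hx : ∀ i, MemLp (x i) 2 ρ)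
    (horth : Pairwise fun i j => ∫ ω, x i ω * x j ω ∂ρ = 0) (I : Finset ι) :
    ∫ ω, (∑ i ∈ I, x i ω) ^ 2 ∂ρ = ∑ i ∈ I, ∫ ω, x i ω ^ 2 ∂ρ := by
  have hint : ∀ i j, Integrable (fun ω => x i ω * x j ω) ρ :=
    fun i j => (hx i).integrable_mul (hx j)
  simp_rw [sq, Finset.sum_mul_sum]
  rw [integral_finsetSum _ fun i _ => integrable_finsetSum _ fun j _ => hint i j]
  refine Finset.sum_congr rfl fun i hi => ?_
  rw [integral_finsetSum _ fun j _ => hint i j]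
  exact Finset.sum_eq_single_of_mem i hi fun j _ hji => horth hji.symm

variable [IsFiniteMeasure ρ] {x : ℕ → Ω → ℝ} {C : ℝ}

lemma integral_cesaroMean_sq_le (hm : ∀ i, AEStronglyMeasurable (x i) ρ)
    (hx : ∀ i ω, |x i ω| ≤ C) (horth : Pairwise fun i j => ∫ ω, x i ω * x j ω ∂ρ = 0) (n : ℕ) :
    ∫ ω, cesaroMean (fun i => x i ω) n ^ 2 ∂ρ ≤ ρ.real Set.univ * C ^ 2 / n := by
  have hLp : ∀ i, MemLp (x i) 2 ρ := fun i => MemLp.of_bound (hm i) C (ae_of_all _ (hx i))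
  have hsq : ∀ i, ∫ ω, x i ω ^ 2 ∂ρ ≤ ρ.real Set.univ * C ^ 2 := fun i =>
    calc ∫ ω, x i ω ^ 2 ∂ρ ≤ ∫ _, C ^ 2 ∂ρ :=
          integral_mono (hLp i).integrable_sq (integrable_const _) fun ω =>
            sq_le_sq' (abs_le.1 (hx i ω)).1 (abs_le.1 (hx i ω)).2
      _ = ρ.real Set.univ * C ^ 2 := by rw [integral_const, smul_eq_mul]
  simp_rw [cesaroMean, div_pow]
  rw [integral_div, integral_sum_sq_of_orthogonal hLp horth]
  rcases n.eq_zero_or_pos with rfl | hn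
  · simp
  rw [div_le_div_iff₀ (by positivity) (by positivity)]
  calc (∑ i ∈ Finset.range n, ∫ ω, x i ω ^ 2 ∂ρ) * n
      ≤ (∑ _i ∈ Finset.range n, ρ.real Set.univ * C ^ 2) * n := by gcongr; exact hsq _
    _ = ρ.real Set.univ * C ^ 2 * n ^ 2 := by
        rw [Finset.sum_const, Finset.card_range, nsmul_eq_mul]
        ring

-- Rajchman's strong law: the second moments of the means are summable along the squares.
lemma ae_tendsto_cesaroMean_of_orthogonal (hm : ∀ i, AEStronglyMeasurable (x i) ρ)
    (hx : ∀ i ω, |x i ω| ≤ C) (horth : Pairwise fun i j => ∫ ω, x i ω * x j ω ∂ρ = 0) :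
    ∀ᵐ ω ∂ρ, Tendsto (cesaroMean fun i => x i ω) atTop (𝓝 0) := by
  have hint : ∀ n, Integrable (fun ω => cesaroMean (fun i => x i ω) n ^ 2) ρ := fun n => by
    refine Integrable.of_bound (C := C ^ 2) ?_ (ae_of_all _ fun ω => ?_)
    · simp only [cesaroMean]
      fun_prop
    · rw [norm_pow, Real.norm_eq_abs]
      gcongr
      exact abs_cesaroMean_le (fun i => hx i ω) n
  have hsum : Summable fun k : ℕ => ∫ ω, cesaroMean (fun i => x i ω) ((k + 1) ^ 2) ^ 2 ∂ρ := by
    refine Summable.of_nonneg_of_le (fun k => integral_nonneg fun ω => sq_nonneg _)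
      (fun k => integral_cesaroMean_sq_le hm hx horth _) ?_
    simp only [div_eq_mul_inv, Nat.cast_pow]
    exact ((summable_nat_add_iff 1).2 (Real.summable_nat_pow_inv.2 one_lt_two)).mul_left _
  filter_upwards [ae_tendsto_zero_of_summable_integral (fun k => hint ((k + 1) ^ 2))
    (fun k ω => sq_nonneg _) hsum] with ω hω
  refine tendsto_cesaroMean_of_tendsto_sq (fun i => hx i ω) ?_
  have habs := hω.sqrt
  simp only [Real.sqrt_sq_eq_abs, Real.sqrt_zero] at habs
  exact (tendsto_zero_iff_abs_tendsto_zero _).2 habs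

end OrthogonalSequences

section Trajectories

open Preorder (frestrictLe frestrictLe₂)

variable {X : ℕ → Type*} [∀ n, MeasurableSpace (X n)] {μ₀ : Measure (X 0)}
  [IsProbabilityMeasure μ₀] {κ : (n : ℕ) → Kernel (Π i : Finset.Iic n, X i) (X (n + 1))}
  [∀ n, IsMarkovKernel (κ n)]

lemma ae_trajMeasure_of_forall_ae {t : ℕ} {P : (Π i : Finset.Iic t, X i) × X (t + 1) → Prop}
    (hP : MeasurableSet {a | P a}) (h : ∀ u, ∀ᵐ z ∂κ t u, P (u, z)) :
    ∀ᵐ ω ∂Kernel.trajMeasure μ₀ κ, P (frestrictLe t ω, ω (t + 1)) := by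
  have hae := Measure.ae_compProd_of_ae_ae (μ := (Kernel.trajMeasure μ₀ κ).map (frestrictLe t))
    hP (ae_of_all _ h)
  rw [Kernel.map_frestrictLe_trajMeasure_compProd_eq_map_trajMeasure] at hae
  exact ae_of_ae_map (by fun_prop) hae

lemma integral_trajMeasure_succ {E : Type*} [NormedAddCommGroup E] [NormedSpace ℝ E] {t : ℕ}
    {φ : (Π i : Finset.Iic t, X i) × X (t + 1) → E} (hφ : StronglyMeasurable φ)
    (hint : Integrable (fun ω => φ (frestrictLe t ω, ω (t + 1))) (Kernel.trajMeasure μ₀ κ)) :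
    ∫ ω, φ (frestrictLe t ω, ω (t + 1)) ∂Kernel.trajMeasure μ₀ κ
      = ∫ ω, ∫ z, φ (frestrictLe t ω, z) ∂κ t (frestrictLe t ω) ∂Kernel.trajMeasure μ₀ κ := by
  have hpair : Measurable fun ω : Π n, X n => (frestrictLe (π := X) t ω, ω (t + 1)) := by fun_prop
  rw [← integral_map hpair.aemeasurable hφ.aestronglyMeasurable,
    ← Kernel.map_frestrictLe_trajMeasure_compProd_eq_map_trajMeasure, Measure.integral_compProd,
    integral_map (by fun_prop) hφ.integral_kernel_prod_right'.aestronglyMeasurable]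
  rw [Kernel.map_frestrictLe_trajMeasure_compProd_eq_map_trajMeasure]
  exact (integrable_map_measure hφ.aestronglyMeasurable hpair.aemeasurable).2 hint

variable {φ : ∀ t, (Π i : Finset.Iic t, X i) × X (t + 1) → ℝ} {C : ℝ}

lemma integral_mul_trajMeasure_eq_zero (hφ : ∀ t, Measurable (φ t)) (hC : ∀ t a, |φ t a| ≤ C)
    (hmean : ∀ t u, ∫ z, φ t (u, z) ∂κ t u = 0) {i j : ℕ} (hij : i < j) :
    ∫ ω, φ i (frestrictLe i ω, ω (i + 1)) * φ j (frestrictLe j ω, ω (j + 1))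
      ∂Kernel.trajMeasure μ₀ κ = 0 := by
  set ψ : (Π k : Finset.Iic j, X k) × X (j + 1) → ℝ := fun a =>
    φ i (frestrictLe₂ hij.le a.1, a.1 ⟨i + 1, Finset.mem_Iic.2 hij⟩) * φ j a with hψ
  have hψm : Measurable ψ := by fun_prop
  have hint : Integrable (fun ω => ψ (frestrictLe j ω, ω (j + 1))) (Kernel.trajMeasure μ₀ κ) := by
    refine Integrable.of_bound (C := C * C) (hψm.comp (by fun_prop)).aestronglyMeasurable
      (ae_of_all _ fun ω => ?_)
    rw [hψ, norm_mul]
    exact mul_le_mul (hC _ _) (hC _ _) (norm_nonneg _)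
      ((abs_nonneg _).trans (hC j (frestrictLe j ω, ω (j + 1))))
  calc ∫ ω, ψ (frestrictLe j ω, ω (j + 1)) ∂Kernel.trajMeasure μ₀ κ
      = ∫ ω, ∫ z, ψ (frestrictLe j ω, z) ∂κ j (frestrictLe j ω) ∂Kernel.trajMeasure μ₀ κ :=
        integral_trajMeasure_succ hψm.stronglyMeasurable hint
    _ = 0 := by simp [hψ, integral_const_mul, hmean]

lemma ae_tendsto_cesaroMean_trajMeasure (hφ : ∀ t, Measurable (φ t)) (hC : ∀ t a, |φ t a| ≤ C)
    (hmean : ∀ t u, ∫ z, φ t (u, z) ∂κ t u = 0) :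
    ∀ᵐ ω ∂Kernel.trajMeasure μ₀ κ,
      Tendsto (cesaroMean fun t => φ t (frestrictLe t ω, ω (t + 1))) atTop (𝓝 0) := by
  refine ae_tendsto_cesaroMean_of_orthogonal
    (fun t => ((hφ t).comp (by fun_prop)).aestronglyMeasurable) (fun t ω => hC t _) ?_
  intro i j hij
  rcases hij.lt_or_gt with h | h
  · exact integral_mul_trajMeasure_eq_zero hφ hC hmean h
  · simp_rw [mul_comm (φ i _)]
    exact integral_mul_trajMeasure_eq_zero hφ hC hmean h

end Trajectories

section SampleFrequencies

variable {P : Type*}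

open Classical in
/-- The frequency of `a` among the first `n` terms of the sample `p`. -/
noncomputable def sampleFreq (p : ℕ → P) (n : ℕ) (a : P) : ℝ :=
  cesaroMean (fun i => if p i = a then 1 else 0) n

lemma sampleFreq_eq_zero {p : ℕ → P} {a : P} (ha : ∀ i, p i ≠ a) (n : ℕ) :
    sampleFreq p n a = 0 := by
  simp [sampleFreq, cesaroMean, ha]

variable [Fintype P]

lemma cesaroMean_comp (p : ℕ → P) (φ : P → ℝ) (n : ℕ) :
    cesaroMean (fun i => φ (p i)) n = ∑ a, sampleFreq p n a * φ a := by
  classical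
  simp only [sampleFreq, ← cesaroMean_mul_const, ← cesaroMean_sum, ite_mul, one_mul, zero_mul,
    Finset.sum_ite_eq, Finset.mem_univ, if_true]

lemma eventually_forall_abs_cesaroMean_sub_lt {p : ℕ → P} {w : P → ℝ}
    (hw : ∀ a, Tendsto (fun n => sampleFreq p n a) atTop (𝓝 (w a))) (C : ℝ) {ε : ℝ} (hε : 0 < ε) :
    ∀ᶠ n in atTop, ∀ φ : P → ℝ, (∀ a, |φ a| ≤ C) →
      |cesaroMean (fun i => φ (p i)) n - ∑ a, w a * φ a| < ε := by
  have hlim : Tendsto (fun n => ∑ a, |sampleFreq p n a - w a| * C) atTop (𝓝 0) := by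
    simpa using tendsto_finsetSum Finset.univ fun a _ => (((hw a).sub_const (w a)).abs.mul_const C)
  filter_upwards [hlim.eventually (gt_mem_nhds hε)] with n hn φ hφ
  calc |cesaroMean (fun i => φ (p i)) n - ∑ a, w a * φ a|
      = |∑ a, (sampleFreq p n a - w a) * φ a| := by
        rw [cesaroMean_comp, ← Finset.sum_sub_distrib]
        simp only [sub_mul]
    _ ≤ ∑ a, |sampleFreq p n a - w a| * C := by
        refine (Finset.abs_sum_le_sum_abs _ _).trans (Finset.sum_le_sum fun a _ => ?_)
        rw [abs_mul]
        exact mul_le_mul_of_nonneg_left (hφ a) (abs_nonneg _)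
    _ < ε := hn

end SampleFrequencies

section MeanLog

variable {P : Type*} [Fintype P]

/-- The mean of `log q` under the weights `w`. Since `Real.log 0 = 0`, it has its usual meaning only
if `q` does not vanish on the support of `w`. -/
noncomputable def meanLog (w q : P → ℝ) : ℝ :=
  ∑ a, w a * Real.log (q a)

variable {w q : P → ℝ}

lemma tendsto_meanLog {ι : Type*} {F : Filter ι} {g : ι → P → ℝ}
    (hg : ∀ a, Tendsto (fun i => g i a) F (𝓝 (q a))) (hq : ∀ a, w a ≠ 0 → q a ≠ 0) :
    Tendsto (fun i => meanLog w (g i)) F (𝓝 (meanLog w q)) := by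
  refine tendsto_finsetSum _ fun a _ => ?_
  by_cases ha : w a = 0
  · simpa only [ha, zero_mul] using tendsto_const_nhds
  · exact ((hg a).log (hq a ha)).const_mul _

lemma tendsto_meanLog_max (hq : ∀ a, 0 ≤ q a) (hpos : ∀ a, w a ≠ 0 → 0 < q a) :
    Tendsto (fun c : ℝ => meanLog w fun a => max (q a) c) (𝓝[>] 0) (𝓝 (meanLog w q)) := by
  refine tendsto_meanLog (fun a => ?_) fun a ha => (hpos a ha).ne'
  have hmax : Tendsto (fun c : ℝ => max (q a) c) (𝓝 0) (𝓝 (max (q a) 0)) :=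
    (continuous_const.max continuous_id).tendsto 0
  rw [max_eq_left (hq a)] at hmax
  exact hmax.mono_left nhdsWithin_le_nhds

lemma tendsto_meanLog_max_atBot (hw : ∀ a, 0 ≤ w a) (hq : ∀ a, q a ≤ 1) {b : P}
    (hwb : 0 < w b) (hqb : q b = 0) :
    Tendsto (fun c : ℝ => meanLog w fun a => max (q a) c) (𝓝[>] 0) atBot := by
  classical
  refine tendsto_atBot_mono' _ ?_ (Real.tendsto_log_nhdsGT_zero.const_mul_atBot hwb)
  filter_upwards [Ioc_mem_nhdsGT (zero_lt_one' ℝ)] with c hc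
  rw [meanLog, ← Finset.add_sum_erase _ _ (Finset.mem_univ b), hqb, max_eq_right hc.1.le]
  refine add_le_of_nonpos_right (Finset.sum_nonpos fun a _ => ?_)
  exact mul_nonpos_of_nonneg_of_nonpos (hw a)
    (Real.log_nonpos (hc.1.le.trans (le_max_right _ _)) (max_le (hq a) hc.2))

lemma eventually_meanLog_max_lt (hw : ∀ a, 0 ≤ w a) (hq : ∀ a, q a ∈ Set.Icc (0 : ℝ) 1) {r : ℝ}
    (hr : (∀ a, 0 < w a → 0 < q a) → meanLog w q < r) :
    ∀ᶠ c : ℝ in 𝓝[>] 0, meanLog w (fun a => max (q a) c) < r := by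
  by_cases hpos : ∀ a, 0 < w a → 0 < q a
  · exact (tendsto_meanLog_max (fun a => (hq a).1)
      fun a ha => hpos a ((hw a).lt_of_ne' ha)).eventually (gt_mem_nhds (hr hpos))
  · push Not at hpos
    obtain ⟨b, hwb, hqb⟩ := hpos
    exact (tendsto_meanLog_max_atBot hw (fun a => (hq a).2) hwb
      (le_antisymm hqb (hq b).1)).eventually (eventually_lt_atBot r)

lemma continuous_meanLog_max {T : Type*} [TopologicalSpace T] {q : T → P → ℝ}
    (hqc : ∀ a, Continuous fun θ => q θ a) (w : P → ℝ) {c : ℝ} (hc : 0 < c) :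
    Continuous fun θ => meanLog w fun a => max (q θ a) c :=
  continuous_finsetSum _ fun a _ => continuous_const.mul
    (((hqc a).max continuous_const).log fun _ => (hc.trans_le (le_max_right _ _)).ne')

lemma abs_log_max_le {x c : ℝ} (hc : 0 < c) (hx : x ≤ 1) :
    |Real.log (max x c)| ≤ |Real.log c| := by
  rcases le_total x c with hxc | hcx
  · rw [max_eq_right hxc]
  · rw [max_eq_left hcx, abs_of_nonpos (Real.log_nonpos (hc.le.trans hcx) hx)]
    exact (neg_le_neg (Real.log_le_log hc hcx)).trans (neg_le_abs _)

end MeanLog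

section Likelihood

variable {P T : Type*} {q : T → P → ℝ} {p : ℕ → P}

/-- The likelihood of the first `n` terms of the sample `p` under the model `q θ`. -/
noncomputable def likelihood (q : T → P → ℝ) (p : ℕ → P) (n : ℕ) (θ : T) : ℝ :=
  ∏ i ∈ Finset.range n, q θ (p i)

lemma likelihood_nonneg (hq : ∀ θ a, q θ a ∈ Set.Icc (0 : ℝ) 1) (n : ℕ) (θ : T) :
    0 ≤ likelihood q p n θ :=
  Finset.prod_nonneg fun i _ => (hq θ (p i)).1

lemma likelihood_le_one (hq : ∀ θ a, q θ a ∈ Set.Icc (0 : ℝ) 1) (n : ℕ) (θ : T) :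
    likelihood q p n θ ≤ 1 :=
  Finset.prod_le_one (fun i _ => (hq θ (p i)).1) fun i _ => (hq θ (p i)).2

lemma likelihood_eq_exp {θ : T} (hpos : ∀ i, 0 < q θ (p i)) (n : ℕ) :
    likelihood q p n θ = Real.exp (n * cesaroMean (fun i => Real.log (q θ (p i))) n) := by
  rcases n.eq_zero_or_pos with rfl | hn
  · simp [likelihood]
  have hn' : (n : ℝ) ≠ 0 := by positivity
  rw [cesaroMean, mul_div_cancel₀ _ hn', Real.exp_sum]
  exact Finset.prod_congr rfl fun i _ => (Real.exp_log (hpos i)).symm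

variable [TopologicalSpace T]

lemma continuous_likelihood (hqc : ∀ a, Continuous fun θ => q θ a) (n : ℕ) :
    Continuous (likelihood q p n) :=
  continuous_finsetProd _ fun i _ => hqc (p i)

variable [Fintype P] {w : P → ℝ}

lemma exists_isOpen_likelihood_le (hq : ∀ θ a, q θ a ∈ Set.Icc (0 : ℝ) 1)
    (hqc : ∀ a, Continuous fun θ => q θ a)
    (hw : ∀ a, Tendsto (fun n => sampleFreq p n a) atTop (𝓝 (w a))) {θ₀ : T} {c r : ℝ}
    (hc : 0 < c) (hr : meanLog w (fun a => max (q θ₀ a) c) < r) :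
    ∃ U, IsOpen U ∧ θ₀ ∈ U ∧
      ∀ᶠ n : ℕ in atTop, ∀ θ ∈ U, likelihood q p n θ ≤ Real.exp (n * r) := by
  obtain ⟨r', hr', hr'r⟩ := exists_between hr
  refine ⟨{θ | meanLog w (fun a => max (q θ a) c) < r'},
    isOpen_lt (continuous_meanLog_max hqc w hc) continuous_const, hr', ?_⟩
  filter_upwards [eventually_forall_abs_cesaroMean_sub_lt hw |Real.log c| (sub_pos.2 hr'r)]
    with n hn θ hθ
  have hmean := (abs_lt.1 (hn _ fun a => abs_log_max_le hc (hq θ a).2)).2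
  calc likelihood q p n θ ≤ likelihood (fun θ a => max (q θ a) c) p n θ :=
        Finset.prod_le_prod (fun i _ => (hq θ (p i)).1) fun i _ => le_max_left _ _
    _ = Real.exp (n * cesaroMean (fun i => Real.log (max (q θ (p i)) c)) n) :=
        likelihood_eq_exp (q := fun θ a => max (q θ a) c)
          (fun i => hc.trans_le (le_max_right _ _)) n
    _ ≤ Real.exp (n * r) := by
        gcongr
        rw [meanLog] at hθ
        linarith

lemma exists_isOpen_le_likelihood (hq : ∀ θ a, q θ a ∈ Set.Icc (0 : ℝ) 1)
    (hqc : ∀ a, Continuous fun θ => q θ a)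
    (hw : ∀ a, Tendsto (fun n => sampleFreq p n a) atTop (𝓝 (w a))) {θ₁ : T} {r : ℝ}
    (hpos : ∀ i, 0 < q θ₁ (p i)) (hr : r < meanLog w (q θ₁)) :
    ∃ V, IsOpen V ∧ θ₁ ∈ V ∧
      ∀ᶠ n : ℕ in atTop, ∀ θ ∈ V, Real.exp (n * r) ≤ likelihood q p n θ := by
  have hsupp : ∀ a, w a ≠ 0 → 0 < q θ₁ a := fun a ha => by
    by_contra hqa
    refine ha (tendsto_nhds_unique (hw a) ?_)
    simp only [sampleFreq_eq_zero fun i (hi : p i = a) => hqa (hi ▸ hpos i), tendsto_const_nhds]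
  obtain ⟨r', hrr', hr'⟩ := exists_between hr
  have hsmall : ∀ᶠ c : ℝ in 𝓝[>] 0, ∀ a, 0 < q θ₁ a → c < q θ₁ a :=
    eventually_all.2 fun a => eventually_imp_distrib_left.2 fun ha =>
      nhdsWithin_le_nhds (gt_mem_nhds ha)
  have hlog := (tendsto_meanLog_max (fun a => (hq θ₁ a).1) hsupp).eventually (lt_mem_nhds hr')
  obtain ⟨c, hcq, hcr, hc : 0 < c⟩ := (hsmall.and (hlog.and self_mem_nhdsWithin)).exists
  refine ⟨{θ | ∀ a, 0 < q θ₁ a → c < q θ a} ∩ {θ | r' < meanLog w fun a => max (q θ a) c},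
    ?_, ⟨hcq, hcr⟩, ?_⟩
  · simp only [Set.ofPred_forall]
    exact (isOpen_iInter_of_finite fun a => isOpen_iInter_of_finite fun _ =>
      isOpen_lt continuous_const (hqc a)).inter
        (isOpen_lt continuous_const (continuous_meanLog_max hqc w hc))
  filter_upwards [eventually_forall_abs_cesaroMean_sub_lt hw |Real.log c| (sub_pos.2 hrr')]
    with n hn θ ⟨hθc, hθr⟩
  have hmean : -(r' - r) < cesaroMean (fun i => Real.log (max (q θ (p i)) c)) n
      - meanLog w fun a => max (q θ a) c :=
    (abs_lt.1 (hn _ fun a => abs_log_max_le hc (hq θ a).2)).1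
  have hcp : ∀ i, c < q θ (p i) := fun i => hθc _ (hpos i)
  calc Real.exp (n * r) ≤ Real.exp (n * cesaroMean (fun i => Real.log (max (q θ (p i)) c)) n) := by
        gcongr
        linarith [show r' < meanLog w fun a => max (q θ a) c from hθr]
    _ = likelihood q p n θ := by
        simp only [max_eq_left (hcp _).le, likelihood_eq_exp fun i => hc.trans (hcp i)]

end Likelihood

section Posterior

lemma tendsto_setIntegral_div_integral_zero {α : Type*} [MeasurableSpace α] {μ : Measure α}
    [IsFiniteMeasure μ] {f : ℕ → α → ℝ} (hf0 : ∀ n a, 0 ≤ f n a)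
    (hint : ∀ n, Integrable (f n) μ) {U V : Set α} (hV0 : μ V ≠ 0) {r₀ r₁ : ℝ} (hr : r₀ < r₁)
    (hU : ∀ᶠ n : ℕ in atTop, ∀ a ∈ U, f n a ≤ Real.exp (n * r₀))
    (hV : ∀ᶠ n : ℕ in atTop, ∀ a ∈ V, Real.exp (n * r₁) ≤ f n a) :
    Tendsto (fun n => (∫ a in U, f n a ∂μ) / ∫ a, f n a ∂μ) atTop (𝓝 0) := by
  have hVpos : 0 < μ.real V := ENNReal.toReal_pos hV0 (measure_ne_top _ _)
  have hexp : Tendsto (fun n : ℕ => Real.exp (n * (r₀ - r₁)) * (μ.real U / μ.real V)) atTop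
      (𝓝 (0 * (μ.real U / μ.real V))) :=
    (Real.tendsto_exp_atBot.comp (tendsto_natCast_atTop_atTop.atTop_mul_const_of_neg
      (sub_neg.2 hr))).mul_const _
  rw [zero_mul] at hexp
  refine tendsto_of_tendsto_of_tendsto_of_le_of_le' tendsto_const_nhds hexp
    (Eventually.of_forall fun n =>
      div_nonneg (integral_nonneg (hf0 n)) (integral_nonneg (hf0 n))) ?_
  filter_upwards [hU, hV] with n hUn hVn
  have hnum : ∫ a in U, f n a ∂μ ≤ Real.exp (n * r₀) * μ.real U :=
    (le_abs_self _).trans (norm_setIntegral_le_of_norm_le_const (measure_lt_top _ _) fun a ha => by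
      rw [Real.norm_of_nonneg (hf0 n a)]
      exact hUn a ha)
  have hden : Real.exp (n * r₁) * μ.real V ≤ ∫ a, f n a ∂μ :=
    (mul_le_mul_of_nonneg_left (measureReal_mono hVn) (Real.exp_pos _).le).trans
      (mul_meas_ge_le_integral_of_nonneg (ae_of_all _ (hf0 n)) (hint n) _)
  calc (∫ a in U, f n a ∂μ) / ∫ a, f n a ∂μ
      ≤ Real.exp (n * r₀) * μ.real U / (Real.exp (n * r₁) * μ.real V) := by gcongr
    _ = Real.exp (n * (r₀ - r₁)) * (μ.real U / μ.real V) := by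
        rw [mul_div_mul_comm, ← Real.exp_sub, mul_sub]

variable {P T : Type*} [TopologicalSpace T] [MeasurableSpace T] [OpensMeasurableSpace T]
  {μ : Measure T} [IsFiniteMeasure μ] {q : T → P → ℝ} {p : ℕ → P}

lemma integrable_likelihood (hq : ∀ θ a, q θ a ∈ Set.Icc (0 : ℝ) 1)
    (hqc : ∀ a, Continuous fun θ => q θ a) (n : ℕ) : Integrable (likelihood q p n) μ :=
  Integrable.of_bound (continuous_likelihood hqc n).measurable.aestronglyMeasurable (C := 1)
    (ae_of_all _ fun θ => by
      rw [Real.norm_of_nonneg (likelihood_nonneg hq n θ)]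
      exact likelihood_le_one hq n θ)

variable [μ.IsOpenPosMeasure]

lemma integral_likelihood_pos (hq : ∀ θ a, q θ a ∈ Set.Icc (0 : ℝ) 1)
    (hqc : ∀ a, Continuous fun θ => q θ a) {θ₁ : T} (hpos : ∀ i, 0 < q θ₁ (p i)) (n : ℕ) :
    0 < ∫ θ, likelihood q p n θ ∂μ :=
  integral_pos_of_integrable_nonneg_nonzero (continuous_likelihood hqc n)
    (integrable_likelihood hq hqc n) (likelihood_nonneg hq n)
    (Finset.prod_pos fun i _ => hpos i).ne'

lemma exists_isOpen_tendsto_likelihood_ratio [Fintype P] {w : P → ℝ}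
    (hq : ∀ θ a, q θ a ∈ Set.Icc (0 : ℝ) 1) (hqc : ∀ a, Continuous fun θ => q θ a)
    (hw : ∀ a, Tendsto (fun n => sampleFreq p n a) atTop (𝓝 (w a))) {θ₀ θ₁ : T}
    (hpos : ∀ i, 0 < q θ₁ (p i)) {c : ℝ} (hc : 0 < c)
    (hlt : meanLog w (fun a => max (q θ₀ a) c) < meanLog w (q θ₁)) :
    ∃ U, IsOpen U ∧ θ₀ ∈ U ∧ Tendsto
      (fun n => (∫ θ in U, likelihood q p n θ ∂μ) / ∫ θ, likelihood q p n θ ∂μ) atTop (𝓝 0) := by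
  obtain ⟨r₀, hr₀, hr₀'⟩ := exists_between hlt
  obtain ⟨r₁, hr₁, hr₁'⟩ := exists_between hr₀'
  obtain ⟨U, hUo, hθ₀, hU⟩ := exists_isOpen_likelihood_le hq hqc hw hc hr₀
  obtain ⟨V, hVo, hθ₁, hV⟩ := exists_isOpen_le_likelihood hq hqc hw hpos hr₁'
  exact ⟨U, hUo, hθ₀, tendsto_setIntegral_div_integral_zero (likelihood_nonneg hq)
    (integrable_likelihood hq hqc) (hVo.measure_pos μ ⟨θ₁, hθ₁⟩).ne' hr₁ hU hV⟩

end Posterior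

lemma continuous_integral_probabilityMeasure {T : Type*} [TopologicalSpace T] [MeasurableSpace T]
    [OpensMeasurableSpace T] {g : T → ℝ} (hg : Continuous g) {C : ℝ} (hC : ∀ θ, |g θ| ≤ C) :
    Continuous fun μ : ProbabilityMeasure T => ∫ θ, g θ ∂(μ : Measure T) :=
  ProbabilityMeasure.continuous_integral_boundedContinuousFunction
    (BoundedContinuousFunction.ofNormedAddCommGroup g hg C hC)

lemma tendsto_strategy_apply {S X : Type*} [Fintype X] {Γ : S → Finset X} {ι : Type*}
    {F : Filter ι} {g : ι → Strategy Γ} {σ : Strategy Γ} (hg : Tendsto g F (𝓝 σ)) (s : S) (x : X) :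
    Tendsto (fun i => (g i).1 s x) F (𝓝 (σ.1 s x)) :=
  tendsto_pi_nhds.1 (tendsto_pi_nhds.1 (tendsto_subtype_rng.1 hg) s) x

section MaximumOverActions

variable {S X : Type*} {Γ : S → Finset X}

lemma Gr.IsMaxAt.abs_sub_le {u u' : Gr Γ → ℝ} {s : S} {v v' c : ℝ} (h : Gr.IsMaxAt u s v)
    (h' : Gr.IsMaxAt u' s v') (hc : ∀ z, |u z - u' z| ≤ c) : |v - v'| ≤ c := by
  obtain ⟨⟨z, hz, rfl⟩, hu⟩ := h
  obtain ⟨⟨z', hz', rfl⟩, hu'⟩ := h'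
  have hle : u' z ≤ u' z' := hu' ⟨z, hz, rfl⟩
  have hle' : u z' ≤ u z := hu ⟨z', hz', rfl⟩
  have hcz := abs_le.1 (hc z)
  have hcz' := abs_le.1 (hc z')
  exact abs_le.2 ⟨by linarith, by linarith⟩

lemma Gr.exists_continuous_isMaxAt [Finite (Gr Γ)] {α : Type*} [TopologicalSpace α]
    {u : α → Gr Γ → ℝ} (hu : ∀ z, Continuous fun a => u a z) {s : S} (hs : (Γ s).Nonempty) :
    ∃ v : α → ℝ, Continuous v ∧ ∀ a, Gr.IsMaxAt (u a) s (v a) := by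
  classical
  have := Fintype.ofFinite (Gr Γ)
  obtain ⟨x, hx⟩ := hs
  have hne : (Finset.univ.filter fun z : Gr Γ => z.state = s).Nonempty :=
    ⟨⟨(s, x), hx⟩, Finset.mem_filter.2 ⟨Finset.mem_univ _, rfl⟩⟩
  refine ⟨fun a => Finset.sup' _ hne (u a), Continuous.finset_sup'_apply hne fun z _ => hu z,
    fun a => ⟨?_, ?_⟩⟩
  · obtain ⟨z, hz, hmax⟩ := Finset.exists_mem_eq_sup' hne (u a)
    exact ⟨z, (Finset.mem_filter.1 hz).2, hmax.symm⟩
  · rintro _ ⟨z, hz, rfl⟩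
    exact Finset.le_sup' (u a) (Finset.mem_filter.2 ⟨Finset.mem_univ z, hz⟩)

end MaximumOverActions

namespace SMDP

variable {S X : Type*} [Fintype S] [Fintype X] {d : ℕ} {Θ : Set (EuclideanSpace ℝ (Fin d))}

/-- The transition probabilities of the subjective models are continuous in the parameter. -/
def HasContinuousModels (D : SMDP S X Θ) : Prop :=
  ∀ z s', Continuous fun θ : Θ => (D.model θ z).1 s'

variable {D : SMDP S X Θ}

section Updating

lemma model_mem_Icc (θ : Θ) (z : Gr D.Γ) (s' : S) : (D.model θ z).1 s' ∈ Set.Icc (0 : ℝ) 1 :=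
  mem_Icc_of_mem_stdSimplex (D.model θ z).2 s'

lemma Qbar_nonneg (μ : ProbabilityMeasure Θ) (z : Gr D.Γ) (s' : S) : 0 ≤ D.Qbar μ z s' :=
  integral_nonneg fun θ => (model_mem_Icc θ z s').1

lemma toMeasure_bayes {μ : ProbabilityMeasure Θ} {z : Gr D.Γ} {s' : S} (h : 0 < D.Qbar μ z s') :
    (D.bayes z s' μ : Measure Θ) = (ENNReal.ofReal (D.Qbar μ z s'))⁻¹ •
      (μ : Measure Θ).withDensity fun θ => ENNReal.ofReal ((D.model θ z).1 s') :=
  congrArg _ (dif_pos h)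

variable (hcont : D.HasContinuousModels)
include hcont

lemma sum_Qbar (μ : ProbabilityMeasure Θ) (z : Gr D.Γ) : ∑ s', D.Qbar μ z s' = 1 := by
  have hint : ∀ s', Integrable (fun θ => (D.model θ z).1 s') (μ : Measure Θ) := fun s' =>
    .of_mem_Icc 0 1 (hcont z s').measurable.aemeasurable
      (ae_of_all _ fun θ => model_mem_Icc θ z s')
  simp only [Qbar]
  rw [← integral_finsetSum _ fun s' _ => hint s']
  simp [(D.model _ z).2.2]

lemma continuous_Qbar (z : Gr D.Γ) (s' : S) : Continuous fun μ => D.Qbar μ z s' :=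
  continuous_integral_probabilityMeasure (C := 1) (hcont z s') fun θ => by
    rw [abs_of_nonneg (model_mem_Icc θ z s').1]
    exact (model_mem_Icc θ z s').2

lemma integral_bayes {μ : ProbabilityMeasure Θ} {z : Gr D.Γ} {s' : S} (h : 0 < D.Qbar μ z s')
    (g : Θ → ℝ) : ∫ θ, g θ ∂(D.bayes z s' μ : Measure Θ)
      = (∫ θ, g θ * (D.model θ z).1 s' ∂(μ : Measure Θ)) / D.Qbar μ z s' := by
  rw [toMeasure_bayes h, integral_smul_measure, integral_withDensity_eq_integral_toReal_smul
      (hcont z s').measurable.ennreal_ofReal (ae_of_all _ fun _ => ENNReal.ofReal_lt_top),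
    ENNReal.toReal_inv, ENNReal.toReal_ofReal h.le, smul_eq_mul, ← div_eq_inv_mul]
  simp only [smul_eq_mul, ENNReal.toReal_ofReal (model_mem_Icc _ z s').1, mul_comm]

lemma continuousAt_bayes {μ : ProbabilityMeasure Θ} {z : Gr D.Γ} {s' : S}
    (h : 0 < D.Qbar μ z s') : ContinuousAt (D.bayes z s') μ := by
  refine ProbabilityMeasure.tendsto_iff_forall_integral_tendsto.2 fun g => ?_
  have hQ := (continuous_Qbar hcont z s').tendsto μ
  have hg := (continuous_integral_probabilityMeasure (C := ‖g‖) (g.continuous.mul (hcont z s'))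
    fun θ => ?_).tendsto μ
  · rw [integral_bayes hcont h]
    refine (hg.div hQ h.ne').congr' ?_
    filter_upwards [hQ.eventually (lt_mem_nhds h)] with ν hν
    exact (integral_bayes hcont hν g).symm
  · rw [Pi.mul_apply, abs_mul, abs_of_nonneg (model_mem_Icc θ z s').1]
    exact (mul_le_of_le_one_right (abs_nonneg _) (model_mem_Icc θ z s').2).trans
      (g.norm_coe_le_norm θ)

end Updating

section Bellman

variable {δ : ℝ} {W : S → ProbabilityMeasure Θ → ℝ}

lemma bayesActionValue_eq_actionValue {μ : ProbabilityMeasure Θ} (h : δ = 0 ∨ D.Exhausted μ) :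
    D.bayesActionValue δ W μ = D.actionValue δ (D.Qbar μ) fun s => W s μ := by
  funext z
  refine Finset.sum_congr rfl fun s' _ => ?_
  rcases h with rfl | h
  · simp only [zero_mul]
  · rcases (Qbar_nonneg μ z s').eq_or_lt with h0 | h0
    · simp only [← h0, mul_zero]
    · rw [← h z s' h0]

variable (hcont : D.HasContinuousModels)
include hcont

-- The Bayesian operator is discontinuous where `Q̄_μ` vanishes, but there it carries no weight.
lemma continuous_comp_bayes_mul_Qbar {u : ProbabilityMeasure Θ → ℝ} (hu : Continuous u) {C : ℝ}
    (hC : ∀ μ, |u μ| ≤ C) (z : Gr D.Γ) (s' : S) :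
    Continuous fun μ => u (D.bayes z s' μ) * D.Qbar μ z s' := by
  refine continuous_iff_continuousAt.2 fun μ => ?_
  have hQ := (continuous_Qbar hcont z s').tendsto μ
  rcases (Qbar_nonneg μ z s').eq_or_lt with h0 | h0
  · rw [ContinuousAt, ← h0, mul_zero]
    rw [← h0] at hQ
    exact bdd_le_mul_tendsto_zero' C (Eventually.of_forall fun ν => hC _) hQ
  · exact (hu.continuousAt.comp (continuousAt_bayes hcont h0)).mul hQ

lemma continuous_bayesActionValue (hW : ∀ s, Continuous (W s)) {C : ℝ} (hC : ∀ s μ, |W s μ| ≤ C)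
    (z : Gr D.Γ) : Continuous fun μ => D.bayesActionValue δ W μ z := by
  simp only [bayesActionValue, add_mul, mul_assoc]
  exact continuous_finsetSum _ fun s' _ => ((continuous_Qbar hcont z s').const_mul _).add
    ((continuous_comp_bayes_mul_Qbar hcont (hW s') (hC s') z s').const_mul _)

lemma abs_bayesActionValue_sub_le {u : S → ProbabilityMeasure Θ → ℝ} {c : ℝ}
    (hc : ∀ s μ, |W s μ - u s μ| ≤ c) (μ : ProbabilityMeasure Θ) (z : Gr D.Γ) :
    |D.bayesActionValue δ W μ z - D.bayesActionValue δ u μ z| ≤ |δ| * c := by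
  calc |D.bayesActionValue δ W μ z - D.bayesActionValue δ u μ z|
      = |∑ s', δ * (W s' (D.bayes z s' μ) - u s' (D.bayes z s' μ)) * D.Qbar μ z s'| := by
        rw [bayesActionValue, bayesActionValue, ← Finset.sum_sub_distrib]
        congr 1
        exact Finset.sum_congr rfl fun s' _ => by ring
    _ ≤ ∑ s', |δ| * c * D.Qbar μ z s' := by
        refine (Finset.abs_sum_le_sum_abs _ _).trans (Finset.sum_le_sum fun s' _ => ?_)
        rw [abs_mul, abs_mul, abs_of_nonneg (Qbar_nonneg μ z s')]
        exact mul_le_mul_of_nonneg_right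
          (mul_le_mul_of_nonneg_left (hc s' _) (abs_nonneg δ)) (Qbar_nonneg μ z s')
    _ = |δ| * c := by rw [← Finset.mul_sum, sum_Qbar hcont, mul_one]

-- Value iteration starting from zero: the iterates are continuous, and the Bellman operator
-- contracts by the factor `|δ|`.
lemma IsBayesValue.exists_continuous_abs_sub_le (hW : D.IsBayesValue δ W) {C : ℝ}
    (hC : ∀ s μ, |W s μ| ≤ C) (n : ℕ) :
    ∃ u : S → ProbabilityMeasure Θ → ℝ,
      (∀ s, Continuous (u s)) ∧ ∀ s μ, |W s μ - u s μ| ≤ |δ| ^ n * C := by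
  induction n with
  | zero => exact ⟨0, fun _ => continuous_zero, by simpa using hC⟩
  | succ n ih =>
    obtain ⟨u, hu, hWu⟩ := ih
    have hbdd : ∀ s μ, |u s μ| ≤ C + |δ| ^ n * C := fun s μ => by
      have htri := abs_sub_abs_le_abs_sub (u s μ) (W s μ)
      rw [abs_sub_comm] at htri
      linarith [hC s μ, hWu s μ]
    choose v hv hmax using fun s => Gr.exists_continuous_isMaxAt
      (fun z => continuous_bayesActionValue (δ := δ) hcont hu hbdd z) (D.Γ_nonempty s)
    refine ⟨v, hv, fun s μ => (hW.2 s μ).abs_sub_le (hmax s μ) fun z => ?_⟩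
    rw [pow_succ', mul_assoc]
    exact abs_bayesActionValue_sub_le hcont hWu μ z

lemma IsBayesValue.continuous (hδ : |δ| < 1) (hW : D.IsBayesValue δ W) (s : S) :
    Continuous (W s) := by
  obtain ⟨C, hC⟩ := hW.1
  choose u hu hWu using hW.exists_continuous_abs_sub_le hcont hC
  have hgeom : Tendsto (fun n : ℕ => |δ| ^ n * C) atTop (𝓝 0) := by
    simpa using (tendsto_pow_atTop_nhds_zero_of_lt_one (abs_nonneg δ) hδ).mul_const C
  have hunif : TendstoUniformly (fun n => u n s) (W s) atTop :=
    Metric.tendstoUniformly_iff.2 fun ε hε =>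
      (hgeom.eventually (gt_mem_nhds hε)).mono fun n hn μ => (hWu n s μ).trans_lt hn
  exact hunif.continuous (Frequently.of_forall fun n => hu n s)

lemma isOptimal_of_tendsto (hδ : |δ| < 1) {f : ProbabilityMeasure Θ → Strategy D.Γ}
    (hf : D.IsOptimalPolicy δ f) {ι : Type*} {F : Filter ι} [F.NeBot]
    {β : ι → ProbabilityMeasure Θ} {μ : ProbabilityMeasure Θ} {σ : Strategy D.Γ}
    (hβ : Tendsto β F (𝓝 μ)) (hσ : Tendsto (fun i => f (β i)) F (𝓝 σ))
    (hμ : δ = 0 ∨ D.Exhausted μ) : D.IsOptimal δ (D.Qbar μ) σ := by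
  obtain ⟨W, hW, hopt⟩ := hf
  obtain ⟨C, hC⟩ := hW.1
  have hlim : ∀ z, Tendsto (fun i => D.bayesActionValue δ W (β i) z) F
      (𝓝 (D.bayesActionValue δ W μ z)) := fun z =>
    ((continuous_bayesActionValue hcont (hW.continuous hcont hδ) hC z).tendsto μ).comp hβ
  refine ⟨fun s => W s μ, fun s => ?_, fun z hz z' hzz' => ?_⟩
  · rw [← bayesActionValue_eq_actionValue hμ]
    exact hW.2 s μ
  · rw [← bayesActionValue_eq_actionValue hμ]
    have heval := tendsto_strategy_apply hσ z.state z.action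
    exact le_of_tendsto_of_tendsto (hlim z') (hlim z)
      ((heval.eventually (lt_mem_nhds hz)).mono fun i hi => hopt (β i) z hi z' hzz')

end Bellman

end SMDP

section OutcomeLaw

variable {S X : Type*} [Fintype S] [Fintype X] {Γ : S → Finset X} (p : stdSimplex ℝ S)
  (g : Strategy Γ)

lemma integral_outcomeLaw (φ : Gr Γ → ℝ) :
    ∫ z, φ z ∂outcomeLaw p g = ∑ z, p.1 z.state * g.1 z.state z.action * φ z := by
  have hfin : ∀ z : Gr Γ, IsFiniteMeasure
      (ENNReal.ofReal (p.1 z.state * g.1 z.state z.action) • Measure.dirac z) :=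
    fun z => (Measure.dirac z).smul_finite ENNReal.ofReal_ne_top
  rw [outcomeLaw, integral_finsetSum_measure fun z _ => Integrable.of_finite]
  refine Finset.sum_congr rfl fun z _ => ?_
  rw [integral_smul_measure, integral_dirac, ENNReal.toReal_ofReal
    (mul_nonneg (p.2.1 _) ((g.2 _).1.1 _)), smul_eq_mul]

open Classical in
lemma sum_strategy_eq_one (s : S) :
    ∑ z : Gr Γ, (if z.state = s then g.1 z.state z.action else 0) = 1 := by
  simpa [Pi.single_apply] using sum_weights ⟨Pi.single s 1, single_mem_stdSimplex ℝ s⟩ g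

lemma integral_state_outcomeLaw (φ : S → ℝ) :
    ∫ z, φ z.state ∂outcomeLaw p g = ∑ s, p.1 s * φ s := by
  classical
  calc ∫ z, φ z.state ∂outcomeLaw p g
      = ∑ z : Gr Γ, p.1 z.state * g.1 z.state z.action * φ z.state := integral_outcomeLaw p g _
    _ = ∑ z : Gr Γ, ∑ s, p.1 s * φ s * (if z.state = s then g.1 z.state z.action else 0) := by
        simp [mul_right_comm]
    _ = ∑ s, p.1 s * φ s := by
        rw [Finset.sum_comm]
        simp only [← Finset.mul_sum, sum_strategy_eq_one, mul_one]

open Classical in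
lemma integral_indicator_outcomeLaw (z : Gr Γ) :
    ∫ y, (if y = z then 1 else 0) ∂outcomeLaw p g = p.1 z.state * g.1 z.state z.action := by
  simp [integral_outcomeLaw]

lemma ae_outcomeLaw_pos : ∀ᵐ z ∂outcomeLaw p g, 0 < p.1 z.state := by
  rw [outcomeLaw, ← Measure.sum_fintype, Measure.ae_sum_iff]
  intro z
  by_cases hz : 0 < p.1 z.state
  · exact Measure.ae_smul_measure
      ((ae_dirac_iff (p := fun z : Gr Γ => 0 < p.1 z.state) .of_discrete).2 hz) _
  · simp [le_antisymm (not_lt.1 hz) (p.2.1 _)]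

end OutcomeLaw

namespace SMDP

variable {S X : Type*} [Fintype S] [Fintype X] {d : ℕ} {Θ : Set (EuclideanSpace ℝ (Fin d))}
  {D : SMDP S X Θ}

section HistoryLaw

open Preorder (frestrictLe)

variable (μ₀ : ProbabilityMeasure Θ) (f : ProbabilityMeasure Θ → Strategy D.Γ)

lemma belief_congr {h h' : ℕ → Gr D.Γ} {t : ℕ} (hh : ∀ i ≤ t, h i = h' i) :
    D.belief μ₀ h t = D.belief μ₀ h' t := by
  induction t with
  | zero => rfl
  | succ t ih =>
    rw [belief, belief, ih fun i hi => hh i (hi.trans t.le_succ), hh t t.le_succ, hh (t + 1) le_rfl]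

lemma extend_frestrictLe (h : ℕ → Gr D.Γ) {t i : ℕ} (hi : i ≤ t) :
    D.extend (frestrictLe (π := fun _ => Gr D.Γ) t h) i = h i := by
  simp [extend, frestrictLe, hi]

lemma belief_extend_frestrictLe (h : ℕ → Gr D.Γ) (t : ℕ) :
    D.belief μ₀ (D.extend (frestrictLe (π := fun _ => Gr D.Γ) t h)) t = D.belief μ₀ h t :=
  belief_congr μ₀ fun _ hi => extend_frestrictLe h hi

lemma ae_historyLaw_transition_pos :
    ∀ᵐ h ∂D.historyLaw μ₀ f, ∀ t, 0 < (D.Q (h t)).1 (h (t + 1)).state := by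
  refine ae_all_iff.2 fun t => ?_
  have hae := ae_trajMeasure_of_forall_ae (X := fun _ => Gr D.Γ) (μ₀ := outcomeLaw D.q₀ (f μ₀))
    (κ := D.stepKernel μ₀ f) (P := fun a => 0 < (D.Q (D.extend a.1 t)).1 a.2.state)
    (Set.to_countable _).measurableSet fun u => ae_outcomeLaw_pos _ _
  simp only [extend_frestrictLe _ le_rfl] at hae
  exact hae

open Classical in
/-- The difference between the indicator of a transition from `z` to `s'` in period `t` and its
conditional probability given the outcome of period `t`, counted if this outcome is `z`. -/
noncomputable def transitionNoise (h : ℕ → Gr D.Γ) (z : Gr D.Γ) (s' : S) (t : ℕ) : ℝ :=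
  if h t = z then (if (h (t + 1)).state = s' then 1 else 0) - (D.Q z).1 s' else 0

open Classical in
/-- The difference between the indicator of the outcome `z` in period `t + 1` and the probability
with which the policy `f` prescribes its action, counted if the state of that period is the state
of `z`. -/
noncomputable def actionNoise (h : ℕ → Gr D.Γ) (z : Gr D.Γ) (t : ℕ) : ℝ :=
  if (h (t + 1)).state = z.state then
    (if h (t + 1) = z then 1 else 0) - (f (D.belief μ₀ h (t + 1))).1 z.state z.action
  else 0

lemma ae_tendsto_cesaroMean_transitionNoise (z : Gr D.Γ) (s' : S) :
    ∀ᵐ h ∂D.historyLaw μ₀ f, Tendsto (cesaroMean (transitionNoise h z s')) atTop (𝓝 0) := by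
  classical
  have hQ := (mem_Icc_of_mem_stdSimplex (D.Q z).2 s')
  have hae := ae_tendsto_cesaroMean_trajMeasure (X := fun _ => Gr D.Γ)
    (μ₀ := outcomeLaw D.q₀ (f μ₀)) (κ := D.stepKernel μ₀ f) (C := 1)
    (φ := fun t a => if D.extend a.1 t = z then
      (if a.2.state = s' then 1 else 0) - (D.Q z).1 s' else 0)
    (fun t => measurable_of_countable _) (fun t a => ?_) fun t u => ?_
  · simp only [extend_frestrictLe _ le_rfl] at hae
    exact hae
  · rw [abs_le]
    constructor <;> split_ifs <;> linarith [hQ.1, hQ.2]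
  · dsimp only
    split_ifs with hz
    · change ∫ y, _ ∂outcomeLaw _ _ = 0
      rw [integral_state_outcomeLaw (φ := fun s => (if s = s' then 1 else 0) - (D.Q z).1 s'), hz]
      simp [mul_sub, ← Finset.sum_mul, (D.Q z).2.2]
    · exact integral_zero _ _

lemma ae_tendsto_cesaroMean_actionNoise (z : Gr D.Γ) :
    ∀ᵐ h ∂D.historyLaw μ₀ f, Tendsto (cesaroMean (actionNoise μ₀ f h z)) atTop (𝓝 0) := by
  classical
  have hae := ae_tendsto_cesaroMean_trajMeasure (X := fun _ => Gr D.Γ)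
    (μ₀ := outcomeLaw D.q₀ (f μ₀)) (κ := D.stepKernel μ₀ f) (C := 1)
    (φ := fun t a => if a.2.state = z.state then (if a.2 = z then 1 else 0) -
      (f (D.bayes (D.extend a.1 t) a.2.state (D.belief μ₀ (D.extend a.1) t))).1 z.state z.action
      else 0)
    (fun t => measurable_of_countable _) (fun t a => ?_) fun t u => ?_
  · simp only [extend_frestrictLe _ le_rfl, belief_extend_frestrictLe] at hae
    exact hae
  · have hf := mem_Icc_of_mem_stdSimplex ((f (D.bayes (D.extend a.1 t) a.2.state
      (D.belief μ₀ (D.extend a.1) t))).2 z.state).1 z.action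
    rw [abs_le]
    constructor <;> split_ifs <;> linarith [hf.1, hf.2]
  · set p := D.Q (D.extend u t)
    set g := D.nextStrategy f (D.belief μ₀ (D.extend u) t) (D.extend u t) with hg
    calc ∫ y, _ ∂outcomeLaw p g
        = ∫ y, (if y = z then 1 else 0)
            - (if y.state = z.state then g.1 z.state z.action else 0) ∂outcomeLaw p g := by
          refine integral_congr_ae (ae_of_all _ fun y => ?_)
          by_cases hs : y.state = z.state
          · simp only [hs, if_true, hg, nextStrategy]
          · simp [hs, show y ≠ z from fun h => hs (h ▸ rfl)]
      _ = p.1 z.state * g.1 z.state z.action - p.1 z.state * g.1 z.state z.action := by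
          rw [integral_sub .of_finite .of_finite, integral_indicator_outcomeLaw,
            integral_state_outcomeLaw
              (φ := fun s => if s = z.state then g.1 z.state z.action else 0)]
          simp
      _ = 0 := sub_self _

/-- The almost sure properties of histories on which the asymptotic analysis rests: only possible
transitions occur, and both sources of noise average out. -/
structure IsTypical (h : ℕ → Gr D.Γ) : Prop where
  transition_pos : ∀ t, 0 < (D.Q (h t)).1 (h (t + 1)).state
  tendsto_transitionNoise : ∀ z s', Tendsto (cesaroMean (transitionNoise h z s')) atTop (𝓝 0)
  tendsto_actionNoise : ∀ z, Tendsto (cesaroMean (actionNoise μ₀ f h z)) atTop (𝓝 0)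

lemma ae_isTypical : ∀ᵐ h ∂D.historyLaw μ₀ f, IsTypical μ₀ f h := by
  filter_upwards [ae_historyLaw_transition_pos μ₀ f,
    ae_all_iff.2 fun z => ae_all_iff.2 (ae_tendsto_cesaroMean_transitionNoise μ₀ f z),
    ae_all_iff.2 (ae_tendsto_cesaroMean_actionNoise μ₀ f)] with h hpos htrans hact
  exact ⟨hpos, htrans, hact⟩

end HistoryLaw

section Frequencies

variable {μ₀ : ProbabilityMeasure Θ} {f : ProbabilityMeasure Θ → Strategy D.Γ} {h : ℕ → Gr D.Γ}
  {σ : Strategy D.Γ} {m : OutcomeDist D.Γ}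

/-- The outcome and the new state of each period. -/
def transitions (h : ℕ → Gr D.Γ) (t : ℕ) : Gr D.Γ × S := (h t, (h (t + 1)).state)

/-- The probability of a transition when outcomes are drawn from `m`. -/
noncomputable def transitionWeight (D : SMDP S X Θ) (m : OutcomeDist D.Γ) (a : Gr D.Γ × S) : ℝ :=
  m.1 a.1 * (D.Q a.1).1 a.2

lemma freq_eq_sampleFreq (h : ℕ → Gr D.Γ) (t : ℕ) (z : Gr D.Γ) :
    D.freq h t z = sampleFreq h (t + 1) z := by
  rw [freq, sampleFreq, cesaroMean, Nat.cast_succ, one_div, div_eq_inv_mul]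

lemma Converges.tendsto_sampleFreq (hconv : D.Converges μ₀ f σ m h) (z : Gr D.Γ) :
    Tendsto (fun n => sampleFreq h n z) atTop (𝓝 (m.1 z)) :=
  (tendsto_add_atTop_iff_nat 1).1 ((hconv.2 z).congr fun t => freq_eq_sampleFreq h t z)

lemma IsTypical.tendsto_transitionFreq (hh : IsTypical μ₀ f h) (hconv : D.Converges μ₀ f σ m h)
    (a : Gr D.Γ × S) :
    Tendsto (fun n => sampleFreq (transitions h) n a) atTop (𝓝 (D.transitionWeight m a)) := by
  classical
  obtain ⟨z, s'⟩ := a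
  have hlim := (hh.tendsto_transitionNoise z s').add
    ((hconv.tendsto_sampleFreq z).mul_const ((D.Q z).1 s'))
  rw [zero_add] at hlim
  refine hlim.congr fun n => ?_
  rw [sampleFreq, sampleFreq, ← cesaroMean_mul_const, ← cesaroMean_add]
  congr 1
  funext t
  by_cases hz : h t = z <;> simp [transitionNoise, transitions, hz]

open Classical in
lemma IsTypical.tendsto_stateFreq (hh : IsTypical μ₀ f h) (hconv : D.Converges μ₀ f σ m h) (s : S) :
    Tendsto (cesaroMean fun t => if (h (t + 1)).state = s then 1 else 0) atTop
      (𝓝 (∑ z, (D.Q z).1 s * m.1 z)) := by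
  have hlim := tendsto_finsetSum Finset.univ fun (a : Gr D.Γ × S) _ =>
    (hh.tendsto_transitionFreq hconv a).mul_const (if a.2 = s then 1 else 0)
  have hsum : ∑ a : Gr D.Γ × S, D.transitionWeight m a * (if a.2 = s then 1 else 0)
      = ∑ z, (D.Q z).1 s * m.1 z := by
    simp [Fintype.sum_prod_type, transitionWeight, mul_comm]
  rw [hsum] at hlim
  exact hlim.congr fun n =>
    (cesaroMean_comp (transitions h) (fun a => if a.2 = s then 1 else 0) n).symm

lemma IsTypical.isStationary (hh : IsTypical μ₀ f h) (hconv : D.Converges μ₀ f σ m h) :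
    D.IsStationary σ m := by
  classical
  intro z
  set b : ℕ → ℝ := fun t => if (h (t + 1)).state = z.state then 1 else 0 with hb
  set e : ℕ → ℝ := fun t => b t * ((f (D.belief μ₀ h (t + 1))).1 z.state z.action
    - σ.1 z.state z.action) with he
  have hdrift : Tendsto (cesaroMean e) atTop (𝓝 0) := by
    have hstrat := ((tendsto_strategy_apply hconv.1 z.state z.action).comp
      (tendsto_add_atTop_nat 1)).sub_const (σ.1 z.state z.action)
    rw [sub_self] at hstrat
    refine tendsto_cesaroMean (squeeze_zero_norm (fun t => ?_) (by simpa using hstrat.abs))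
    simp only [he, hb]
    split_ifs <;> simp
  have hdecomp : ∀ n, cesaroMean (actionNoise μ₀ f h z) n + cesaroMean e n
      + cesaroMean b n * σ.1 z.state z.action
      = cesaroMean (fun t => if h (t + 1) = z then 1 else 0) n := fun n => by
    rw [← cesaroMean_mul_const, ← cesaroMean_add, ← cesaroMean_add]
    congr 1
    funext t
    by_cases hs : (h (t + 1)).state = z.state
    · simp [actionNoise, he, hb, hs]
    · simp [actionNoise, he, hb, hs, show h (t + 1) ≠ z from fun hz => hs (hz ▸ rfl)]
  have hlim := ((hh.tendsto_actionNoise z).add hdrift).add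
    ((hh.tendsto_stateFreq hconv z.state).mul_const (σ.1 z.state z.action))
  rw [zero_add, zero_add] at hlim
  rw [tendsto_nhds_unique (tendsto_cesaroMean_succ (hconv.tendsto_sampleFreq z))
    (hlim.congr hdecomp), Finset.sum_mul]
  exact Finset.sum_congr rfl fun y _ => by rw [MDP.transition]; ring

end Frequencies

end SMDP

section ExtendedReals

lemma ereal_coe_sum {ι : Type*} (I : Finset ι) (g : ι → ℝ) :
    ((∑ i ∈ I, g i : ℝ) : EReal) = ∑ i ∈ I, (g i : EReal) :=
  map_sum (⟨⟨Real.toEReal, EReal.coe_zero⟩, EReal.coe_add⟩ : ℝ →+ EReal) g I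

lemma ereal_sum_ne_bot {ι : Type*} {I : Finset ι} {g : ι → EReal} (hg : ∀ i ∈ I, g i ≠ ⊥) :
    ∑ i ∈ I, g i ≠ ⊥ :=
  Finset.sum_induction g (· ≠ ⊥)
    (fun _ _ hx hy hxy => (EReal.add_eq_bot_iff.1 hxy).elim hx hy) EReal.zero_ne_bot hg

lemma ereal_sum_eq_top {ι : Type*} {I : Finset ι} {g : ι → EReal} (hg : ∀ i ∈ I, g i ≠ ⊥) {i : ι}
    (hi : i ∈ I) (htop : g i = ⊤) : ∑ j ∈ I, g j = ⊤ := by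
  classical
  rw [← Finset.add_sum_erase _ _ hi, htop]
  exact EReal.top_add_of_ne_bot (ereal_sum_ne_bot fun j hj => hg j (Finset.mem_of_mem_erase hj))

lemma klTerm_eq_coe {x y : ℝ} (h : x ≠ 0 → y ≠ 0) :
    klTerm x y = ((x * (Real.log x - Real.log y) : ℝ) : EReal) := by
  by_cases hx : x = 0
  · simp [klTerm, hx]
  · rw [klTerm, if_neg hx, if_neg (h hx), Real.log_div hx (h hx)]

lemma klTerm_eq_top {x : ℝ} (hx : x ≠ 0) : klTerm x 0 = ⊤ := by
  rw [klTerm, if_neg hx, if_pos rfl]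

lemma klTerm_ne_bot (x y : ℝ) : klTerm x y ≠ ⊥ := by
  unfold klTerm
  split_ifs
  exacts [EReal.zero_ne_bot, top_ne_bot, EReal.coe_ne_bot _]

end ExtendedReals

namespace SMDP

variable {S X : Type*} [Fintype S] [Fintype X] {d : ℕ} {Θ : Set (EuclideanSpace ℝ (Fin d))}

/-- The subjective transition probabilities `Q_θ(s' ∣ s, x)` as a function of the whole transition,
so that each model is a distribution over the terms of a sample of transitions. -/
noncomputable def modelProb (D : SMDP S X Θ) (θ : Θ) (a : Gr D.Γ × S) : ℝ := (D.model θ a.1).1 a.2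

/-- There are densely many models that give positive probability to every transition that has
positive true probability. -/
def HasDominatingModels (D : SMDP S X Θ) : Prop :=
  ∃ A : Set Θ, Dense A ∧ ∀ θ ∈ A, ∀ z s', 0 < (D.Q z).1 s' → 0 < (D.model θ z).1 s'

variable {D : SMDP S X Θ} {m : OutcomeDist D.Γ}

section Divergence

lemma transitionWeight_nonneg (m : OutcomeDist D.Γ) (a : Gr D.Γ × S) :
    0 ≤ D.transitionWeight m a :=
  mul_nonneg (m.2.1 a.1) ((D.Q a.1).2.1 a.2)

lemma wKLD_eq_coe {θ : Θ} (h : ∀ a, 0 < D.transitionWeight m a → 0 < D.modelProb θ a) :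
    D.wKLD m θ = ((meanLog (D.transitionWeight m) (fun a => (D.Q a.1).1 a.2)
      - meanLog (D.transitionWeight m) (D.modelProb θ) : ℝ) : EReal) := by
  have hterm : ∀ z : Gr D.Γ, (m.1 z : EReal) * ∑ s', klTerm ((D.Q z).1 s') ((D.model θ z).1 s')
      = ((∑ s', m.1 z * ((D.Q z).1 s' *
          (Real.log ((D.Q z).1 s') - Real.log ((D.model θ z).1 s'))) : ℝ) : EReal) := fun z => by
    rcases (m.2.1 z).eq_or_lt' with hz | hz
    · simp [hz]
    have hkl : ∀ s', (D.Q z).1 s' ≠ 0 → (D.model θ z).1 s' ≠ 0 := fun s' hs' =>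
      (h (z, s') (mul_pos hz (((D.Q z).2.1 s').lt_of_ne' hs'))).ne'
    simp only [klTerm_eq_coe (hkl _), ← ereal_coe_sum, ← EReal.coe_mul, Finset.mul_sum]
  simp only [wKLD, hterm, ← ereal_coe_sum, meanLog, Fintype.sum_prod_type, transitionWeight,
    modelProb, mul_sub, Finset.sum_sub_distrib, mul_assoc]

lemma wKLD_eq_top {θ : Θ} {a : Gr D.Γ × S} (ha : 0 < D.transitionWeight m a)
    (h : D.modelProb θ a = 0) : D.wKLD m θ = ⊤ := by
  have hm : 0 < m.1 a.1 := pos_of_mul_pos_left ha ((D.Q a.1).2.1 a.2)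
  have hQ : 0 < (D.Q a.1).1 a.2 := pos_of_mul_pos_right ha (m.2.1 a.1)
  have hne : ∀ z, ∑ s', klTerm ((D.Q z).1 s') ((D.model θ z).1 s') ≠ ⊥ := fun z =>
    ereal_sum_ne_bot fun s' _ => klTerm_ne_bot _ _
  have htop : ∑ s', klTerm ((D.Q a.1).1 s') ((D.model θ a.1).1 s') = ⊤ :=
    ereal_sum_eq_top (fun s' _ => klTerm_ne_bot _ _) (Finset.mem_univ a.2)
      ((congrArg _ h).trans (klTerm_eq_top hQ.ne'))
  refine ereal_sum_eq_top (fun z _ => ?_) (Finset.mem_univ a.1)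
    ((congrArg _ htop).trans (EReal.coe_mul_top_of_pos hm))
  rcases (m.2.1 z).eq_or_lt' with hz | hz
  · simp [hz]
  · simp [EReal.mul_eq_bot, hne z, hz.not_gt]

lemma exists_meanLog_lt_of_notMem_closest {θ₀ : Θ} (h : θ₀ ∉ D.closest m) :
    ∃ θ, (∀ a, 0 < D.transitionWeight m a → 0 < D.modelProb θ a) ∧
      ((∀ a, 0 < D.transitionWeight m a → 0 < D.modelProb θ₀ a) →
        meanLog (D.transitionWeight m) (D.modelProb θ₀)
          < meanLog (D.transitionWeight m) (D.modelProb θ)) := by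
  simp only [closest, Set.mem_ofPred_eq, not_forall, not_le] at h
  obtain ⟨θ, hθ⟩ := h
  have hpos : ∀ a, 0 < D.transitionWeight m a → 0 < D.modelProb θ a := fun a ha =>
    (model_mem_Icc θ a.1 a.2).1.lt_of_ne' fun h0 => hθ.ne_top (wKLD_eq_top ha h0)
  refine ⟨θ, hpos, fun hpos₀ => ?_⟩
  rw [wKLD_eq_coe hpos, wKLD_eq_coe hpos₀, EReal.coe_lt_coe_iff] at hθ
  linarith

lemma exists_meanLog_max_lt_of_notMem_closest (hcont : D.HasContinuousModels) {A : Set Θ}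
    (hA : Dense A) {θ₀ : Θ} (h : θ₀ ∉ D.closest m) :
    ∃ θ ∈ A, ∃ c > 0, meanLog (D.transitionWeight m) (fun a => max (D.modelProb θ₀ a) c)
      < meanLog (D.transitionWeight m) (D.modelProb θ) := by
  obtain ⟨θ', hpos, hlt⟩ := exists_meanLog_lt_of_notMem_closest h
  obtain ⟨c, hcθ', hc⟩ := ((eventually_meanLog_max_lt (transitionWeight_nonneg m)
    (fun a => model_mem_Icc θ₀ a.1 a.2) hlt).and self_mem_nhdsWithin).exists
  have hlim : Tendsto (fun θ => meanLog (D.transitionWeight m) (D.modelProb θ)) (𝓝 θ')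
      (𝓝 (meanLog (D.transitionWeight m) (D.modelProb θ'))) :=
    tendsto_meanLog (fun a => (hcont a.1 a.2).tendsto θ')
      fun a ha => (hpos a ((transitionWeight_nonneg m a).lt_of_ne' ha)).ne'
  obtain ⟨θ, hθA, hθ⟩ := hA.inter_nhds_nonempty (hlim.eventually (lt_mem_nhds hcθ'))
  exact ⟨θ, hθA, c, hc, hθ⟩

end Divergence

section Belief

variable {μ₀ : ProbabilityMeasure Θ} {h : ℕ → Gr D.Γ}

lemma integral_belief (hcont : D.HasContinuousModels)
    (hpos : ∀ t, 0 < ∫ θ, likelihood D.modelProb (transitions h) t θ ∂(μ₀ : Measure Θ)) (t : ℕ)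
    (g : Θ → ℝ) : ∫ θ, g θ ∂(D.belief μ₀ h t : Measure Θ)
      = (∫ θ, g θ * likelihood D.modelProb (transitions h) t θ ∂(μ₀ : Measure Θ))
        / ∫ θ, likelihood D.modelProb (transitions h) t θ ∂(μ₀ : Measure Θ) := by
  induction t generalizing g with
  | zero => simp [belief, likelihood]
  | succ t ih =>
    have hsucc : ∀ θ, (D.model θ (h t)).1 (h (t + 1)).state
        * likelihood D.modelProb (transitions h) t θ
        = likelihood D.modelProb (transitions h) (t + 1) θ := fun θ => by
      rw [likelihood, likelihood, Finset.prod_range_succ, mul_comm]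
      rfl
    have hQbar : D.Qbar (D.belief μ₀ h t) (h t) (h (t + 1)).state
        = (∫ θ, likelihood D.modelProb (transitions h) (t + 1) θ ∂(μ₀ : Measure Θ))
          / ∫ θ, likelihood D.modelProb (transitions h) t θ ∂(μ₀ : Measure Θ) := by
      simp only [Qbar, ih, hsucc]
    have hQpos := hQbar ▸ div_pos (hpos (t + 1)) (hpos t)
    rw [belief, integral_bayes hcont hQpos, ih, hQbar, div_div_div_cancel_right₀ (hpos t).ne']
    simp only [mul_assoc, hsucc]

lemma measureReal_belief (hcont : D.HasContinuousModels)
    (hpos : ∀ t, 0 < ∫ θ, likelihood D.modelProb (transitions h) t θ ∂(μ₀ : Measure Θ)) (t : ℕ)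
    {U : Set Θ} (hU : MeasurableSet U) : (D.belief μ₀ h t : Measure Θ).real U
      = (∫ θ in U, likelihood D.modelProb (transitions h) t θ ∂(μ₀ : Measure Θ))
        / ∫ θ, likelihood D.modelProb (transitions h) t θ ∂(μ₀ : Measure Θ) := by
  rw [← integral_indicator_one hU, integral_belief hcont hpos, ← integral_indicator hU]
  congr 2
  funext θ
  by_cases hθ : θ ∈ U <;> simp [hθ]

lemma exists_isOpen_tendsto_belief_zero (hcont : D.HasContinuousModels)
    (hdom : D.HasDominatingModels) (hμ₀ : FullSupport μ₀)
    (hQ : ∀ t, 0 < (D.Q (h t)).1 (h (t + 1)).state)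
    (hfreq : ∀ a, Tendsto (fun n => sampleFreq (transitions h) n a) atTop
      (𝓝 (D.transitionWeight m a))) {θ₀ : Θ} (hθ₀ : θ₀ ∉ D.closest m) :
    ∃ U, IsOpen U ∧ θ₀ ∈ U ∧ Tendsto (fun t => (D.belief μ₀ h t : Measure Θ) U) atTop (𝓝 0) := by
  have : (μ₀ : Measure Θ).IsOpenPosMeasure := ⟨fun U hU hne => (hμ₀ U hU hne).ne'⟩
  have hIcc : ∀ θ a, D.modelProb θ a ∈ Set.Icc (0 : ℝ) 1 := fun θ a => model_mem_Icc θ a.1 a.2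
  have hqc : ∀ a, Continuous fun θ => D.modelProb θ a := fun a => hcont a.1 a.2
  obtain ⟨A, hA, hApos⟩ := hdom
  obtain ⟨θ₁, hθ₁, c, hc, hlt⟩ := exists_meanLog_max_lt_of_notMem_closest hcont hA hθ₀
  have hθ₁pos : ∀ t, 0 < D.modelProb θ₁ (transitions h t) := fun t => hApos θ₁ hθ₁ _ _ (hQ t)
  obtain ⟨U, hU, hθ₀U, hlim⟩ := exists_isOpen_tendsto_likelihood_ratio (μ := (μ₀ : Measure Θ))
    hIcc hqc hfreq hθ₁pos hc hlt
  refine ⟨U, hU, hθ₀U, (ENNReal.tendsto_toReal_zero_iff fun t => measure_ne_top _ _).1 ?_⟩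
  exact hlim.congr fun t =>
    (measureReal_belief hcont (integral_likelihood_pos hIcc hqc hθ₁pos) t hU.measurableSet).symm

lemma ae_mem_closest_of_tendsto (hcont : D.HasContinuousModels) (hdom : D.HasDominatingModels)
    (hμ₀ : FullSupport μ₀) (hQ : ∀ t, 0 < (D.Q (h t)).1 (h (t + 1)).state)
    (hfreq : ∀ a, Tendsto (fun n => sampleFreq (transitions h) n a) atTop
      (𝓝 (D.transitionWeight m a))) {F : Filter ℕ} [F.NeBot] (hF : F ≤ atTop)
    {μ : ProbabilityMeasure Θ} (hμ : Tendsto (D.belief μ₀ h) F (𝓝 μ)) :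
    ∀ᵐ θ ∂(μ : Measure Θ), θ ∈ D.closest m := by
  refine measure_null_of_locally_null _ fun θ₀ hθ₀ => ?_
  obtain ⟨U, hU, hθ₀U, hlim⟩ := exists_isOpen_tendsto_belief_zero hcont hdom hμ₀ hQ hfreq hθ₀
  refine ⟨U, mem_nhdsWithin_of_mem_nhds (hU.mem_nhds hθ₀U), le_antisymm ?_ zero_le⟩
  calc (μ : Measure Θ) U ≤ F.liminf fun t => (D.belief μ₀ h t : Measure Θ) U :=
        ProbabilityMeasure.le_liminf_measure_open_of_tendsto hμ hU
    _ = 0 := (hlim.mono_left hF).liminf_eq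

end Belief

section Equilibrium

variable {δ : ℝ} {μ₀ : ProbabilityMeasure Θ} {f : ProbabilityMeasure Θ → Strategy D.Γ}
  {σ : Strategy D.Γ}

lemma exists_isTypical {H : Set (ℕ → Gr D.Γ)} (hH : 0 < D.historyLaw μ₀ f H) :
    ∃ h ∈ H, IsTypical μ₀ f h :=
  ((frequently_ae_mem_iff.2 hH.ne').and_eventually (ae_isTypical μ₀ f)).exists

lemma IsTypical.isBerkNash {h : ℕ → Gr D.Γ} (hh : IsTypical μ₀ f h)
    (hconv : D.Converges μ₀ f σ m h) (hcont : D.HasContinuousModels)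
    (hdom : D.HasDominatingModels) (hμ₀ : FullSupport μ₀) (hδ : |δ| < 1)
    (hf : D.IsOptimalPolicy δ f) {F : Filter ℕ} [F.NeBot] (hF : F ≤ atTop)
    {μ : ProbabilityMeasure Θ} (hμ : Tendsto (D.belief μ₀ h) F (𝓝 μ))
    (hex : δ = 0 ∨ D.Exhausted μ) : D.IsBerkNash δ σ m :=
  ⟨μ, isOptimal_of_tendsto hcont hδ hf hμ (hconv.1.mono_left hF) hex,
    ae_mem_closest_of_tendsto hcont hdom hμ₀ hh.transition_pos
      (hh.tendsto_transitionFreq hconv) hF hμ, hh.isStationary hconv⟩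

lemma IsStable.isBerkNash_zero (hs : D.IsStable μ₀ f σ m) (hΘ : IsCompact Θ)
    (hcont : D.HasContinuousModels) (hdom : D.HasDominatingModels) (hμ₀ : FullSupport μ₀)
    (hf : D.IsOptimalPolicy 0 f) : D.IsBerkNash 0 σ m := by
  obtain ⟨H, -, hH, hconv⟩ := hs
  obtain ⟨h, hhH, hh⟩ := exists_isTypical hH
  have : CompactSpace Θ := isCompact_iff_compactSpace.1 hΘ
  obtain ⟨μ, hμ⟩ := exists_clusterPt_of_compactSpace (map (D.belief μ₀ h) atTop)
  obtain ⟨F, hF, hFμ⟩ := mapClusterPt_iff_ultrafilter.1 hμ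
  exact hh.isBerkNash (hconv h hhH) hcont hdom hμ₀ (by simp) hf hF hFμ (Or.inl rfl)

lemma IsStableExhaustive.isBerkNash (hs : D.IsStableExhaustive μ₀ f σ m)
    (hcont : D.HasContinuousModels) (hdom : D.HasDominatingModels) (hμ₀ : FullSupport μ₀)
    (hδ : |δ| < 1) (hf : D.IsOptimalPolicy δ f) : D.IsBerkNash δ σ m := by
  obtain ⟨H, -, hH, hconv⟩ := hs
  obtain ⟨h, hhH, hh⟩ := exists_isTypical hH
  obtain ⟨hconv, μ, φ, hφ, hμ, hex⟩ := hconv h hhH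
  exact hh.isBerkNash hconv hcont hdom hμ₀ hδ hf (F := map φ atTop) hφ.tendsto_atTop
    (tendsto_map'_iff.2 hμ) (Or.inr hex)

end Equilibrium

end SMDP

theorem theorem2_general {S X : Type*} [Fintype S] [Fintype X] {d : ℕ}
    {Θ : Set (EuclideanSpace ℝ (Fin d))} (D : SMDP S X Θ) (hcont : D.HasContinuousModels)
    (hdom : D.HasDominatingModels) (μ₀ : ProbabilityMeasure Θ) (hμ₀ : FullSupport μ₀)
    (f : ProbabilityMeasure Θ → Strategy D.Γ) (σ : Strategy D.Γ) (m : OutcomeDist D.Γ) :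
    (IsCompact Θ → D.IsOptimalPolicy 0 f → D.IsStable μ₀ f σ m → D.IsBerkNash 0 σ m) ∧
      ∀ δ : ℝ, |δ| < 1 → D.IsOptimalPolicy δ f → D.IsStableExhaustive μ₀ f σ m →
        D.IsBerkNash δ σ m :=
  ⟨fun hΘ hf hs => hs.isBerkNash_zero hΘ hcont hdom hμ₀ hf,
    fun _ hδ hf hs => hs.isBerkNash hcont hdom hμ₀ hδ hf⟩

theorem theorem2 {S X : Type*} [Fintype S] [Fintype X] {d : ℕ}
    {Θ : Set (EuclideanSpace ℝ (Fin d))} (D : SMDP S X Θ) :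
    ∃ δbar : ℝ, 0 ≤ δbar ∧ δbar ≤ 1 ∧
      -- (i)
      (∀ δ : ℝ, 0 ≤ δ → δ < 1 → δ ≤ δbar →
        ∀ (μ₀ : ProbabilityMeasure Θ) (f : ProbabilityMeasure Θ → Strategy D.Γ)
          (σ : Strategy D.Γ) (m : OutcomeDist D.Γ),
          D.Regular → FullSupport μ₀ → D.IsOptimalPolicy δ f →
          D.IsStable μ₀ f σ m → D.IsBerkNash δ σ m) ∧
      -- (ii)
      (∀ δ : ℝ, 0 ≤ δ → δ < 1 → δbar < δ →
        ∀ (μ₀ : ProbabilityMeasure Θ) (f : ProbabilityMeasure Θ → Strategy D.Γ)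
          (σ : Strategy D.Γ) (m : OutcomeDist D.Γ),
          D.Regular → FullSupport μ₀ → D.IsOptimalPolicy δ f →
          D.IsStableExhaustive μ₀ f σ m → D.IsBerkNash δ σ m) := by
  refine ⟨0, le_rfl, zero_le_one, fun δ hδ _ hδ0 μ₀ f σ m hR hμ₀ hf hs => ?_,
    fun δ hδ hδ1 _ μ₀ f σ m hR hμ₀ hf hs => ?_⟩
  · obtain rfl := le_antisymm hδ0 hδ
    exact (theorem2_general D hR.continuous hR.dense μ₀ hμ₀ f σ m).1 hR.compact hf hs
  · exact (theorem2_general D hR.continuous hR.dense μ₀ hμ₀ f σ m).2 δ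
      ((abs_of_nonneg hδ).trans_lt hδ1) hf hs
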